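/- **Corruption model.** A dataset $X^{(1)},\dots,X^{(N)}\in(\mathbb R\cup\{*\})^d$ ($*$ marks a missing entry) is *$\varepsilon$-corrupted from $\mathcal P_2$* with mean $\mu$ if a (randomized) adversary generates it as follows, where $\mathcal P_2$ is the class of distributions on $\mathbb R^d$ with finite second moments and covariance $\Sigma\preceq I$. (1) It chooses sets of present coordinates $P^{(i)}\subseteq\{1,\dots,d\}$, $i=1,\dots,N$. (2) It chooses $\mu\in\mathbb R^d$ and $\mathcal D^{(i)}\in\mathcal P_2$ with mean $\mu$, and $X^{(i)}\in\mathbb R^d$ is drawn independently from $\mathcal D^{(i)}$. (3) It modifies at most $\varepsilon N$ of the examples arbitrarily, including their sets $P^{(i)}$; this may depend on all the draws. (4) $X^{(i)}_j$ is replaced by $*$ whenever $j\notin P^{(i)}$. Let $\Gamma_j=\{i: X^{(i)}_j\ne *\}$ in the resulting dataset. The dataset is *$\gamma$-complete* if $|\Gamma_j|\ge\gamma N$ for all $j$. **Goodness.** For a completed dataset $X^{(i,0)}\in\mathbb R^d$ agreeing with $X^{(i)}$ on the present entries, let $X^{(i,\mu)}_j=X^{(i)}_j$ if $X^{(i)}_j\neq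 *$ and $X^{(i,\mu)}_j=X^{(i,0)}_j+\mu_j$ otherwise. For $G\subseteq\{1,\dots,N\}$ and $0<p\le |G|$, let $\Delta_{G,p}$ be the set of weights $w\in\mathbb R^N$ with $0\le w^{(i)}\le 1/p$, $\sum_i w^{(i)}=1$, and $w^{(i)}=0$ for $i\notin G$. The completed dataset is *$(\varepsilon',g_*,\eta,\beta)$-good with respect to $\mu$* if there is $G\subseteq\{1,\dots,N\}$ with $|G|\ge(1-\varepsilon')N$ such that, with $G_j=G\cap\Gamma_j$, $|G_j|/|G|\ge g_*$ for all $j$, and for all $w\in\Delta_{G,(1-3\varepsilon')N}$: $$\Big\|\sum_{i\in G}w^{(i)}(X^{(i,\mu)}-\mu)\Big\|_2\le\beta\sqrt{\varepsilon'},\qquad \Big\|\sum_{i\in G}w^{(i)}(X^{(i,\mu)}-\mu)(X^{(i,\mu)}-\mu)^\top-\eta^2I\Big\|_{\mathrm{op}}\le\beta^2,$$ $$\Big\|\sum_{i\in G_j}w^{(i)}(X^{(i,\mu)}-\mu)\Big\|_2\le\beta\sqrt{\varepsilon'}\quad\text{for all } j=1,\dots,d.$$ **Lemma.** There are absolute constants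 $K,C>0$ such that the following holds for all integers $d\ge1$, $N\ge 0$ and all reals $\varepsilon>0$, $\gamma$, $\delta$ with $11\varepsilon\le\gamma\le1$, $\delta\in(0,1/2)$ and $N\varepsilon\ge K\log(d/\delta)$. For every $\varepsilon$-corrupted dataset from $\mathcal P_2$ with mean $\mu$, the event that the dataset is $\gamma$-complete but its completion by filling every missing entry with $0$ is not $(1.1\varepsilon,\,0.9\gamma,\,0,\,\beta)$-good with respect to $\mu$ happens with probability at most $\delta$, where $$\beta=C\sqrt{\frac{d\log(d/\delta)}{N\varepsilon}+1}.$$ -/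

import Mathlib

open MeasureTheory ProbabilityTheory

noncomputable section

/-- The covariance matrix of a distribution on `ℝ^d`. -/
def covMatrix {d : ℕ} (D : Measure (EuclideanSpace ℝ (Fin d))) : Matrix (Fin d) (Fin d) ℝ :=
  Matrix.of fun j k => cov[fun x => x j, fun x => x k; D]

/-- The class of probability distributions on `ℝ^d` with finite second moments whose covariance
matrix `Σ` satisfies `Σ ⪯ I`. -/
def boundedCovariance (d : ℕ) : Set (Measure (EuclideanSpace ℝ (Fin d))) :=
  {D | IsProbabilityMeasure D ∧ MemLp (fun x => x) 2 D ∧ (1 - covMatrix D).PosSemidef}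

/-- A dataset of `N` examples in `(ℝ ∪ {*})^d`; `none` stands for a missing entry `*`. -/
abbrev IncompleteDataset (d N : ℕ) : Type := Fin N → Fin d → Option ℝ

/-- A dataset of `N` examples in `ℝ^d`. -/
abbrev Dataset (d N : ℕ) : Type := Fin N → EuclideanSpace ℝ (Fin d)

/-- Keep the coordinates in `P i` of the `i`-th example, and conceal the others by `*`. -/
def conceal {d N : ℕ} (P : Fin N → Finset (Fin d)) (X : Dataset d N) : IncompleteDataset d N :=
  fun i j => if j ∈ P i then some (X i j) else none

/-- The set `Γ_j` of examples whose coordinate `j` is present. -/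
def presentIn {d N : ℕ} (X : IncompleteDataset d N) (j : Fin d) : Finset (Fin N) :=
  Finset.univ.filter fun i => (X i j).isSome

/-- A dataset is `γ`-complete if `|Γ_j| ≥ γ N` for every coordinate `j`. -/
def IsGammaComplete {d N : ℕ} (γ : ℝ) (X : IncompleteDataset d N) : Prop :=
  ∀ j, γ * N ≤ ((presentIn X j).card : ℝ)

/-- Fill every missing entry with `0`. -/
def zeroFill {d N : ℕ} (X : IncompleteDataset d N) : Dataset d N :=
  fun i => WithLp.toLp 2 fun j => (X i j).getD 0

/-- The adjustment by `ν` of a completed dataset `X₀` of `X`: entries present in `X` are kept, and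
`ν_j` is added to the filled-in entries of coordinate `j`. -/
def adjust {d N : ℕ} (X : IncompleteDataset d N) (X₀ : Dataset d N)
    (ν : EuclideanSpace ℝ (Fin d)) : Dataset d N :=
  fun i => WithLp.toLp 2 fun j => if (X i j).isSome then X₀ i j else X₀ i j + ν j

/-- The set `Δ_{G,p}` (for `0 < p ≤ |G|`) of probability weights on `{1, …, N}` that vanish
outside `G` and are at most `1 / p`. -/
def boundedWeights {N : ℕ} (G : Finset (Fin N)) (p : ℝ) : Set (Fin N → ℝ) :=
  {w | (∀ i, 0 ≤ w i) ∧ ∑ i, w i = 1 ∧ (∀ i, i ∉ G → w i = 0) ∧ ∀ i, w i ≤ 1 / p}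

/-- The operator norm of a matrix induced by the Euclidean norm. -/
def opNorm {d : ℕ} (M : Matrix (Fin d) (Fin d) ℝ) : ℝ :=
  ‖Matrix.toEuclideanCLM (𝕜 := ℝ) M‖

/-- `X₀`, a completed dataset of `X`, is `(ε, g, η, β)`-good with respect to `μ`. -/
def IsGood {d N : ℕ} (X : IncompleteDataset d N) (X₀ : Dataset d N) (ε g η β : ℝ)
    (μ : EuclideanSpace ℝ (Fin d)) : Prop :=
  ∃ G : Finset (Fin N),
    (1 - ε) * N ≤ (G.card : ℝ) ∧
    (∀ j, g ≤ ((G ∩ presentIn X j).card : ℝ) / (G.card : ℝ)) ∧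
    ∀ w ∈ boundedWeights G ((1 - 3 * ε) * N),
      ‖∑ i ∈ G, w i • (adjust X X₀ μ i - μ)‖ ≤ β * √ε ∧
      opNorm ((∑ i ∈ G, w i •
          Matrix.vecMulVec (⇑(adjust X X₀ μ i - μ)) (⇑(adjust X X₀ μ i - μ)))
        - η ^ 2 • (1 : Matrix (Fin d) (Fin d) ℝ)) ≤ β ^ 2 ∧
      ∀ j, ‖∑ i ∈ G ∩ presentIn X j, w i • (adjust X X₀ μ i - μ)‖ ≤ β * √ε

/-- A (randomized) adversary generating an `ε`-corrupted dataset of `N` examples from the class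
`𝓓` of distributions on `ℝ^d`, run on the probability space `(Ω, Pr)`.

`seed` is the adversary's randomness before the examples are drawn: the present coordinates, the
common mean and the distributions are chosen as functions of it, so they cannot depend on the
draws. The modified examples are arbitrary functions on `Ω`: this last choice may depend on all the
draws, on the seed and on further randomness. -/
structure CorruptionProcess (d N : ℕ) (ε : ℝ) (𝓓 : Set (Measure (EuclideanSpace ℝ (Fin d))))
    {Ω : Type*} [MeasurableSpace Ω] (Pr : Measure Ω) (S : Type*) [MeasurableSpace S] where
  seed : Ω → S
  measurable_seed : Measurable seed
  /-- The present coordinates of every example, before corruption. -/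
  present : S → Fin N → Finset (Fin d)
  measurable_present : ∀ i j, MeasurableSet {s | j ∈ present s i}
  /-- The common mean. -/
  mean : S → EuclideanSpace ℝ (Fin d)
  measurable_mean : Measurable mean
  /-- The distribution of every example. -/
  dist : Fin N → Kernel S (EuclideanSpace ℝ (Fin d))
  dist_mem : ∀ i s, dist i s ∈ 𝓓
  dist_mean : ∀ i s, ∫ x, x ∂(dist i s) = mean s
  /-- The examples as drawn, before corruption. -/
  draw : Ω → Dataset d N
  measurable_draw : Measurable draw
  /-- Given the seed, the examples are independent, the `i`-th one with law `dist i`. -/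
  law_draw : ∀ A : Set S, MeasurableSet A →
    ∀ B : Fin N → Set (EuclideanSpace ℝ (Fin d)), (∀ i, MeasurableSet (B i)) →
      Pr {ω | seed ω ∈ A ∧ ∀ i, draw ω i ∈ B i}
        = ∫⁻ s in A, ∏ i, dist i s (B i) ∂(Pr.map seed)
  /-- The examples after corruption. -/
  draw' : Ω → Dataset d N
  /-- The present coordinates after corruption. -/
  present' : Ω → Fin N → Finset (Fin d)
  /-- At most `ε N` examples are modified. -/
  card_modified : ∀ ω,
    (({i | draw' ω i ≠ draw ω i ∨ present' ω i ≠ present (seed ω) i} : Set (Fin N)).ncard : ℝ)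
      ≤ ε * N

/-- The observed `ε`-corrupted dataset. -/
def CorruptionProcess.observed {d N : ℕ} {ε : ℝ}
    {𝓓 : Set (Measure (EuclideanSpace ℝ (Fin d)))} {Ω : Type*} [MeasurableSpace Ω]
    {Pr : Measure Ω} {S : Type*} [MeasurableSpace S]
    (A : CorruptionProcess d N ε 𝓓 Pr S) (ω : Ω) : IncompleteDataset d N :=
  conceal (A.present' ω) (A.draw' ω)

/-- The true mean, as chosen by the adversary. -/
def CorruptionProcess.trueMean {d N : ℕ} {ε : ℝ}
    {𝓓 : Set (Measure (EuclideanSpace ℝ (Fin d)))} {Ω : Type*} [MeasurableSpace Ω]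
    {Pr : Measure Ω} {S : Type*} [MeasurableSpace S]
    (A : CorruptionProcess d N ε 𝓓 Pr S) (ω : Ω) : EuclideanSpace ℝ (Fin d) :=
  A.mean (A.seed ω)

end

/-! Since missing entries are filled with 0, an entry absent from `X` contributes 0 to `X^(μ) - μ`.
So an unmodified example gives the centred draw with its missing coordinates zeroed. The mask is
fixed before the draws, hence these vectors are, given the seed, independent with mean zero and
covariance at most the identity. Take for `G` the unmodified examples whose masked vector has norm
at most `R = √(100 d / ε)`, and replace the longer vectors by 0 (`truncate`).

Conditionally on the seed, three kinds of bounds hold with high probability. A Chernoff bound shows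
that at most `0.1 ε N` vectors are truncated. The Gram matrix of the truncated vectors is controlled
by the potential `Tr ((L + ∑ v vᵀ)^k)`, and their sum, over all examples or over those with
coordinate `j` present, by the potential `(L + ‖z‖²)^k`, with `k` about `log (d/δ)`. In each case
adding one vector multiplies the expected potential by at most a constant factor
(`trace_rankOne_pow_le`, `add_pow_le_of_small`), so `lintegral_pi_add_sum_le` and Markov's
inequality finish.

The rest is deterministic (`isGood_of_moment_bounds`): admissible weights are within `O(ε)` of
uniform in `ℓ¹` and at most `2 / N`, so Cauchy-Schwarz and the Gram bound carry the uniform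
estimates over to all weights at once. As `η = 0`, the second-moment condition is only an upper
bound. -/

section RankOneUpdates

/-! ### Trace powers under rank-one updates -/

open Matrix Polynomial

theorem mul_vecMulVec_mul_form {n : Type*} [Fintype n] (B D : Matrix n n ℝ) (v : n → ℝ) :
    v ⬝ᵥ ((B * vecMulVec v v * D) *ᵥ v) = (v ⬝ᵥ (D *ᵥ v)) * (v ⬝ᵥ (B *ᵥ v)) := by
  rw [← mulVec_mulVec, ← mulVec_mulVec, vecMulVec_mulVec, op_smul_eq_smul, mulVec_smul,
    dotProduct_smul, smul_eq_mul]

variable {n : Type*} [Fintype n] [DecidableEq n]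

/-- The polynomial functional calculus of a real symmetric matrix, in an orthonormal eigenbasis
(the columns of `U`). -/
theorem exists_spectral_resolution {A : Matrix n n ℝ} (hA : A.IsHermitian) :
    ∃ (l : n → ℝ) (U : Matrix n n ℝ), U * Uᵀ = 1 ∧ Uᵀ * U = 1 ∧
      (∀ (p : ℝ[X]) (v : n → ℝ),
        v ⬝ᵥ (aeval A p *ᵥ v) = ∑ m, (v ᵥ* U) m ^ 2 * p.eval (l m)) ∧
      ∀ p : ℝ[X], (aeval A p).trace = ∑ m, p.eval (l m) := by
  set U : Matrix n n ℝ := (hA.eigenvectorUnitary).val with hU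
  have hstar : star U = Uᵀ := by
    ext i j; simp [Matrix.star_apply]
  have h1 : U * Uᵀ = 1 := by
    rw [← hstar]; exact Unitary.coe_mul_star_self hA.eigenvectorUnitary
  have h2 : Uᵀ * U = 1 := by
    rw [← hstar]; exact Unitary.coe_star_mul_self hA.eigenvectorUnitary
  have hspec : A = U * diagonal hA.eigenvalues * Uᵀ := by
    conv_lhs => rw [hA.spectral_theorem, Unitary.conjStarAlgAut_apply]
    rw [← hstar]; rfl
  have hpoly : ∀ p : ℝ[X],
      aeval A p = U * diagonal (fun m => p.eval (hA.eigenvalues m)) * Uᵀ := by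
    intro p
    induction p using Polynomial.induction_on' with
    | add p q hp hq =>
      rw [map_add, hp, hq, ← add_mul, ← mul_add, diagonal_add]
      simp
    | monomial k a =>
      have hpow : ∀ k : ℕ, A ^ k = U * diagonal (fun m => hA.eigenvalues m ^ k) * Uᵀ := by
        intro k
        induction k with
        | zero => simp [h1]
        | succ k ih =>
          rw [pow_succ, ih]
          nth_rewrite 2 [hspec]
          calc U * diagonal (fun m => hA.eigenvalues m ^ k) * Uᵀ *
                (U * diagonal hA.eigenvalues * Uᵀ)
              = U * diagonal (fun m => hA.eigenvalues m ^ k) * (Uᵀ * U) *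
                diagonal hA.eigenvalues * Uᵀ := by simp only [Matrix.mul_assoc]
            _ = _ := by
              rw [h2, Matrix.mul_one, Matrix.mul_assoc U, diagonal_mul_diagonal]
              simp only [pow_succ]
      rw [aeval_monomial, hpow, ← Algebra.smul_def, ← Matrix.smul_mul, ← Matrix.mul_smul,
        ← diagonal_smul]
      simp [Pi.smul_def]
  refine ⟨hA.eigenvalues, U, h1, h2, fun p v => ?_, fun p => ?_⟩
  · rw [hpoly, ← mulVec_mulVec, ← mulVec_mulVec, dotProduct_mulVec, mulVec_transpose,
      dotProduct]
    refine Finset.sum_congr rfl fun m _ => ?_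
    rw [mulVec_diagonal]; ring
  · rw [hpoly, trace_mul_comm, ← Matrix.mul_assoc, h2, Matrix.one_mul, trace_diagonal]

theorem sum_sq_vecMul_of_orthogonal {U : Matrix n n ℝ} (hU : U * Uᵀ = 1) (v : n → ℝ) :
    ∑ m, (v ᵥ* U) m ^ 2 = v ⬝ᵥ v := by
  calc ∑ m, (v ᵥ* U) m ^ 2 = (v ᵥ* U) ⬝ᵥ (v ᵥ* U) := by simp [dotProduct, sq]
    _ = v ⬝ᵥ v := by
      rw [← dotProduct_mulVec, ← mulVec_transpose U v, mulVec_mulVec, hU, one_mulVec]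

/-- Eigenvalues lie above any lower bound of the quadratic form. -/
theorem le_eigenvalue_of_le_form {A U : Matrix n n ℝ} {l : n → ℝ} {L : ℝ} (hU : Uᵀ * U = 1)
    (hform : ∀ (p : ℝ[X]) (v : n → ℝ),
        v ⬝ᵥ (aeval A p *ᵥ v) = ∑ m, (v ᵥ* U) m ^ 2 * p.eval (l m))
    (hL : ∀ v, L * (v ⬝ᵥ v) ≤ v ⬝ᵥ (A *ᵥ v)) (m : n) : L ≤ l m := by
  -- The `m`-th column of `U` is a unit eigenvector, so its form isolates the eigenvalue `l m`.
  have hv : (Uᵀ m) ᵥ* U = Pi.single m 1 := by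
    ext k
    have := congrFun (congrFun hU m) k
    rw [Matrix.mul_apply] at this
    simp only [vecMul, dotProduct]
    rw [this, Matrix.one_apply, Pi.single_apply]
    simp [eq_comm]
  have hone := hform 1 (Uᵀ m)
  have hX := hform X (Uᵀ m)
  rw [hv] at hone hX
  simp only [map_one, one_mulVec, aeval_X, eval_one, eval_X, mul_one, Pi.single_apply, ite_pow,
    one_pow, ne_eq, OfNat.ofNat_ne_zero, not_false_eq_true, zero_pow, ite_mul, one_mul, zero_mul,
    Finset.sum_ite_eq', Finset.mem_univ, if_true] at hone hX
  have := hL (Uᵀ m)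
  rwa [hone, hX, mul_one] at this

/-- Chebyshev's association inequality with weights. -/
theorem sum_mul_sum_le_of_monovary {ι : Type*} [Fintype ι] {w f g : ι → ℝ} (hw : ∀ i, 0 ≤ w i)
    (hfg : ∀ i j, 0 ≤ (f i - f j) * (g i - g j)) :
    (∑ i, w i * f i) * (∑ i, w i * g i) ≤ (∑ i, w i) * ∑ i, w i * (f i * g i) := by
  have h : 0 ≤ ∑ i, ∑ j, w i * w j * ((f i - f j) * (g i - g j)) :=
    Finset.sum_nonneg fun i _ => Finset.sum_nonneg fun j _ =>
      mul_nonneg (mul_nonneg (hw i) (hw j)) (hfg i j)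
  have e : ∑ i, ∑ j, w i * w j * ((f i - f j) * (g i - g j)) =
      2 * ((∑ i, w i) * ∑ i, w i * (f i * g i)) -
        2 * ((∑ i, w i * f i) * (∑ i, w i * g i)) := by
    have h1 : ∑ i, ∑ j, w i * w j * ((f i - f j) * (g i - g j)) =
        ∑ i, ∑ j, ((w i * (f i * g i)) * w j + w i * (w j * (f j * g j))
          - (w i * f i) * (w j * g j) - (w i * g i) * (w j * f j)) := by
      refine Finset.sum_congr rfl fun i _ => Finset.sum_congr rfl fun j _ => by ring
    rw [h1]
    simp only [Finset.sum_sub_distrib, Finset.sum_add_distrib, ← Finset.sum_mul_sum]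
    ring
  linarith

/-- Both powers are increasing functions of the same nonnegative spectrum, so they are positively
correlated under the spectral weights of `v`. -/
theorem form_mul_form_le {A : Matrix n n ℝ} (hA : A.IsHermitian)
    (hpos : ∀ v, 0 ≤ v ⬝ᵥ (A *ᵥ v)) {r : ℝ} (hr : 0 ≤ r) (v : n → ℝ) (i j : ℕ) :
    (v ⬝ᵥ (A ^ i *ᵥ v)) * (v ⬝ᵥ ((A + r • 1) ^ j *ᵥ v)) ≤
      (v ⬝ᵥ v) * (v ⬝ᵥ (((A + r • 1) ^ j * A ^ i) *ᵥ v)) := by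
  obtain ⟨l, U, hU, hU', hform, -⟩ := exists_spectral_resolution hA
  have hl : ∀ m, 0 ≤ l m := fun m =>
    le_eigenvalue_of_le_form hU' hform (L := 0) (fun v => by simpa using hpos v) m
  have e1 : A ^ i = aeval A (X ^ i : ℝ[X]) := by simp
  have e2 : (A + r • 1) ^ j = aeval A ((X + C r) ^ j : ℝ[X]) := by
    simp [Algebra.algebraMap_eq_smul_one]
  rw [e1, e2, ← map_mul, hform, hform, hform, ← sum_sq_vecMul_of_orthogonal hU]
  simp only [eval_mul, eval_pow, eval_add, eval_X, eval_C, mul_comm ((_ + r) ^ j)]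
  refine sum_mul_sum_le_of_monovary (fun m => sq_nonneg _) fun a b => ?_
  rcases le_total (l a) (l b) with h | h
  · have h1 := pow_le_pow_left₀ (hl a) h i
    have h2 := pow_le_pow_left₀ (add_nonneg (hl a) hr) (add_le_add_left h r) j
    nlinarith
  · have h1 := pow_le_pow_left₀ (hl b) h i
    have h2 := pow_le_pow_left₀ (add_nonneg (hl b) hr) (add_le_add_left h r) j
    nlinarith

/-- Mixed moments of a rank-one update `A + v vᵀ` are dominated by those of `A + |v|²`. -/
theorem form_rankOne_pow_mul_pow_le {A : Matrix n n ℝ} (hA : A.IsHermitian)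
    (hpos : ∀ v, 0 ≤ v ⬝ᵥ (A *ᵥ v)) (v : n → ℝ) (j : ℕ) : ∀ i : ℕ,
    v ⬝ᵥ (((A + vecMulVec v v) ^ j * A ^ i) *ᵥ v) ≤
      v ⬝ᵥ (((A + (v ⬝ᵥ v) • (1 : Matrix n n ℝ)) ^ j * A ^ i) *ᵥ v) := by
  have hr : 0 ≤ v ⬝ᵥ v := by
    rw [dotProduct]; exact Finset.sum_nonneg fun _ _ => mul_self_nonneg _
  have hposi : ∀ i : ℕ, 0 ≤ v ⬝ᵥ (A ^ i *ᵥ v) := by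
    intro i
    obtain ⟨l, U, hU, hU', hform, -⟩ := exists_spectral_resolution hA
    have hl : ∀ m, 0 ≤ l m := fun m =>
      le_eigenvalue_of_le_form hU' hform (L := 0) (fun v => by simpa using hpos v) m
    have e1 : A ^ i = aeval A (X ^ i : ℝ[X]) := by simp
    rw [e1, hform]
    exact Finset.sum_nonneg fun m _ => mul_nonneg (sq_nonneg _) (by simpa using pow_nonneg (hl m) i)
  induction j with
  | zero => intro i; simp
  | succ j ih =>
    intro i
    set M := A + vecMulVec v v with hM
    set B := A + (v ⬝ᵥ v) • (1 : Matrix n n ℝ) with hB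
    -- One factor of `M` is split. The rank-one term factors into a product of two forms, which
    -- induction and `form_mul_form_le` bound by the term that `|v|²` produces in `B`.
    have e1 : M ^ (j + 1) * A ^ i = M ^ j * A ^ (i + 1) + M ^ j * vecMulVec v v * A ^ i := by
      rw [pow_succ M, pow_succ' A, hM]; noncomm_ring
    have e2 : B ^ (j + 1) * A ^ i = B ^ j * A ^ (i + 1) + (v ⬝ᵥ v) • (B ^ j * A ^ i) := by
      rw [pow_succ B, pow_succ' A]
      nth_rewrite 2 [hB]
      rw [mul_add, add_mul, Matrix.mul_smul, Matrix.mul_one, Matrix.smul_mul, Matrix.mul_assoc]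
    rw [e1, e2, add_mulVec, add_mulVec, dotProduct_add, dotProduct_add, mul_vecMulVec_mul_form,
      smul_mulVec, dotProduct_smul, smul_eq_mul]
    have h0 := ih 0
    simp only [pow_zero, mul_one] at h0
    have h1 := form_mul_form_le hA hpos hr v i j
    have h2 := mul_le_mul_of_nonneg_left h0 (hposi i)
    linarith [ih (i + 1)]

/-- Turning the factors `A + v vᵀ` into `A` one at a time costs at most `v ⬝ (A + |v|²)^(k-1) v`
each. Since `|v|² ≤ L / k` and every eigenvalue is at least `L`, the shift by `|v|²` costs a factor
below `e ≤ 3`, and raising the exponent to `k` gains `1 / L`. The resulting error is a quadratic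
form in `v`, whose mean is governed by the covariance. -/
theorem trace_rankOne_pow_le {A : Matrix n n ℝ} (hA : A.IsHermitian) {L : ℝ}
    (hL0 : 0 < L) (hL : ∀ v, L * (v ⬝ᵥ v) ≤ v ⬝ᵥ (A *ᵥ v)) (v : n → ℝ) (k : ℕ)
    (hk : k * (v ⬝ᵥ v) ≤ L) :
    ((A + vecMulVec v v) ^ k).trace ≤ (A ^ k).trace + 3 * k / L * (v ⬝ᵥ (A ^ k *ᵥ v)) := by
  have hr : ∀ v : n → ℝ, 0 ≤ v ⬝ᵥ v := fun v => by
    rw [dotProduct]; exact Finset.sum_nonneg fun _ _ => mul_self_nonneg _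
  have hpos : ∀ v, 0 ≤ v ⬝ᵥ (A *ᵥ v) := fun v =>
    (mul_nonneg hL0.le (hr v)).trans (hL v)
  obtain ⟨l, U, hU, hU', hform, -⟩ := exists_spectral_resolution hA
  have hl : ∀ m, L ≤ l m := le_eigenvalue_of_le_form hU' hform hL
  set r := v ⬝ᵥ v with hrdef
  set M := A + vecMulVec v v with hM
  set B := A + r • (1 : Matrix n n ℝ) with hB
  have hBA : ∀ i j : ℕ, v ⬝ᵥ ((B ^ j * A ^ i) *ᵥ v) ≤ v ⬝ᵥ (B ^ (i + j) *ᵥ v) := by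
    intro i j
    have e1 : A ^ i = aeval A (X ^ i : ℝ[X]) := by simp
    have e2 : ∀ j, B ^ j = aeval A ((X + C r) ^ j : ℝ[X]) := by
      simp [hB, Algebra.algebraMap_eq_smul_one]
    rw [e1, e2, e2, ← map_mul, hform, hform]
    refine Finset.sum_le_sum fun m _ => mul_le_mul_of_nonneg_left ?_ (sq_nonneg _)
    have hlm : 0 ≤ l m := hL0.le.trans (hl m)
    have hlr : 0 ≤ l m + r := add_nonneg hlm (hr v)
    simp only [eval_mul, eval_pow, eval_add, eval_X, eval_C]
    rw [pow_add, mul_comm]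
    gcongr
    exact le_add_of_nonneg_right (hr v)
  have hstep : ∀ j i : ℕ, (A ^ i * M ^ j).trace ≤
      (A ^ (i + j)).trace + j * (v ⬝ᵥ (B ^ (i + j - 1) *ᵥ v)) := by
    intro j
    induction j with
    | zero => intro i; simp
    | succ j ih =>
      intro i
      have e1 : A ^ i * M ^ (j + 1) = A ^ (i + 1) * M ^ j + A ^ i * vecMulVec v v * M ^ j := by
        rw [pow_succ' M, pow_succ A, hM]; noncomm_ring
      have e2 : (A ^ i * vecMulVec v v * M ^ j).trace = v ⬝ᵥ ((M ^ j * A ^ i) *ᵥ v) := by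
        rw [trace_mul_comm, ← Matrix.mul_assoc, mul_vecMulVec, trace_vecMulVec, dotProduct_comm]
      rw [e1, trace_add, e2]
      have h1 := ih (i + 1)
      have h2 := (form_rankOne_pow_mul_pow_le hA hpos v j i).trans (hBA i j)
      have e3 : i + 1 + j = i + (j + 1) := by ring
      have e4 : i + (j + 1) - 1 = i + j := by omega
      rw [e3, e4] at h1
      rw [e4]
      push_cast
      linarith
  have h0 := hstep k 0
  simp only [pow_zero, one_mul, zero_add] at h0
  refine h0.trans (add_le_add_right ?_ _)
  have e1 : A ^ k = aeval A (X ^ k : ℝ[X]) := by simp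
  have e2 : ∀ j, B ^ j = aeval A ((X + C r) ^ j : ℝ[X]) := by
    simp [hB, Algebra.algebraMap_eq_smul_one]
  rw [e1, e2, hform, hform, Finset.mul_sum, Finset.mul_sum]
  refine Finset.sum_le_sum fun m _ => ?_
  simp only [eval_pow, eval_add, eval_X, eval_C]
  rcases Nat.eq_zero_or_pos k with rfl | hkpos
  · simp
  have hk0 : (0 : ℝ) < k := by exact_mod_cast hkpos
  have hlm : 0 < l m := hL0.trans_le (hl m)
  have hrk : r ≤ l m / k := by
    rw [le_div_iff₀ hk0]; linarith [hl m]
  have hb : (l m + r) ^ (k - 1) ≤ 3 * l m ^ (k - 1) := by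
    calc (l m + r) ^ (k - 1) ≤ (l m * (1 + 1 / k)) ^ (k - 1) := by
          refine pow_le_pow_left₀ (add_nonneg hlm.le (hr v)) ?_ _
          rw [mul_add, mul_one, mul_one_div]; linarith
      _ = l m ^ (k - 1) * (1 + 1 / k : ℝ) ^ (k - 1) := mul_pow _ _ _
      _ ≤ l m ^ (k - 1) * 3 := by
          refine mul_le_mul_of_nonneg_left ?_ (pow_nonneg hlm.le _)
          calc (1 + 1 / k : ℝ) ^ (k - 1) ≤ (1 + 1 / k : ℝ) ^ k :=
                pow_le_pow_right₀ (by simp) (Nat.sub_le _ _)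
            _ ≤ Real.exp (1 / k) ^ k := by
                refine pow_le_pow_left₀ (by positivity) ?_ _
                linarith [Real.add_one_le_exp (1 / k : ℝ)]
            _ = Real.exp 1 := by rw [← Real.exp_nat_mul]; field_simp
            _ ≤ 3 := by linarith [Real.exp_one_lt_d9]
      _ = 3 * l m ^ (k - 1) := mul_comm _ _
  have hc : L * l m ^ (k - 1) ≤ l m ^ k := by
    obtain ⟨k', rfl⟩ : ∃ k', k = k' + 1 := ⟨k - 1, by omega⟩
    rw [pow_succ', Nat.add_sub_cancel]
    exact mul_le_mul_of_nonneg_right (hl m) (pow_nonneg hlm.le _)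
  have hd : (l m + r) ^ (k - 1) ≤ 3 / L * l m ^ k := by
    rw [div_mul_eq_mul_div, le_div_iff₀ hL0]; nlinarith
  calc (k : ℝ) * ((v ᵥ* U) m ^ 2 * (l m + r) ^ (k - 1))
      ≤ k * ((v ᵥ* U) m ^ 2 * (3 / L * l m ^ k)) := by gcongr
    _ = 3 * k / L * ((v ᵥ* U) m ^ 2 * l m ^ k) := by ring

/-- The `k`-th power of each eigenvalue is one of the nonnegative summands of the trace. -/
theorem form_le_of_trace_pow_le {A : Matrix n n ℝ} (hA : A.IsHermitian)
    (hpos : ∀ v, 0 ≤ v ⬝ᵥ (A *ᵥ v)) {k : ℕ} (hk : k ≠ 0) {t : ℝ} (ht : 0 ≤ t)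
    (htr : (A ^ k).trace ≤ t ^ k) (u : n → ℝ) : u ⬝ᵥ (A *ᵥ u) ≤ t * (u ⬝ᵥ u) := by
  obtain ⟨l, U, hU, hU', hform, htrace⟩ := exists_spectral_resolution hA
  have hl : ∀ m, 0 ≤ l m := fun m =>
    le_eigenvalue_of_le_form hU' hform (L := 0) (fun v => by simpa using hpos v) m
  have e1 : A ^ k = aeval A (X ^ k : ℝ[X]) := by simp
  rw [e1, htrace] at htr
  simp only [eval_pow, eval_X] at htr
  have hlt : ∀ m, l m ≤ t := by
    intro m
    refine le_of_pow_le_pow_left₀ hk ht (le_trans ?_ htr)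
    exact Finset.single_le_sum (f := fun m => l m ^ k) (fun m _ => pow_nonneg (hl m) k)
      (Finset.mem_univ m)
  have := hform X u
  rw [aeval_X] at this
  rw [this, ← sum_sq_vecMul_of_orthogonal hU u, Finset.mul_sum]
  refine Finset.sum_le_sum fun m _ => ?_
  rw [eval_X, mul_comm]
  exact mul_le_mul_of_nonneg_right (hlt m) (sq_nonneg _)

end RankOneUpdates

/-! ### Iterating a one-step potential bound -/

open scoped ENNReal in
/-- A multiplicative one-step bound for a potential of independent sums iterates. No measurability
of the potential is needed. -/
theorem lintegral_pi_add_sum_le {E M : Type*} [MeasurableSpace E] [AddCommMonoid M] {V : Set M}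
    {Ψ : M → ℝ≥0∞} {c : ℝ≥0∞} (hc : c ≠ ∞) : ∀ {N : ℕ} (ν : Fin N → Measure E)
    [∀ i, IsProbabilityMeasure (ν i)] (f : Fin N → E → M),
    (∀ i, ∀ z ∈ V, ∀ x, z + f i x ∈ V) →
    (∀ i, ∀ z ∈ V, ∫⁻ x, Ψ (z + f i x) ∂(ν i) ≤ c * Ψ z) →
    ∀ z ∈ V, ∫⁻ x, Ψ (z + ∑ i, f i (x i)) ∂(Measure.pi ν) ≤ c ^ N * Ψ z := by
  intro N
  induction N with
  | zero => intro ν _ f _ _ z _; simp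
  | succ N ih =>
    intro ν _ f hV hstep z hz
    have hmp := (measurePreserving_piFinSuccAbove ν 0).symm
    rw [← hmp.map_eq, lintegral_map_equiv]
    -- This half of Tonelli's theorem holds without measurability.
    refine (lintegral_prod_le _).trans ?_
    have hinner : ∀ x₀, ∫⁻ y, Ψ (z + ∑ i, f i
        ((MeasurableEquiv.piFinSuccAbove (fun _ => E) 0).symm (x₀, y) i))
          ∂(Measure.pi fun j => ν (Fin.succAbove 0 j)) ≤ c ^ N * Ψ (z + f 0 x₀) := by
      intro x₀
      have := ih (fun j => ν (Fin.succAbove 0 j)) (fun j => f (Fin.succAbove 0 j))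
        (fun j => hV _) (fun j => hstep _) (z + f 0 x₀) (hV 0 z hz x₀)
      refine le_trans (le_of_eq ?_) this
      refine lintegral_congr fun y => ?_
      rw [Fin.sum_univ_succ, ← add_assoc]
      simp [MeasurableEquiv.piFinSuccAbove, Fin.insertNthEquiv]
    refine (lintegral_mono hinner).trans ?_
    rw [lintegral_const_mul' _ _ (ENNReal.pow_ne_top hc), pow_succ, mul_assoc]
    gcongr
    exact hstep 0 z hz

theorem lintegral_ofReal_le_of_le {E : Type*} [MeasurableSpace E] {D : Measure E} {g h : E → ℝ}
    {c : ℝ} (hg : ∀ x, 0 ≤ g x) (hgh : ∀ x, g x ≤ h x) (hh : Integrable h D)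
    (hc : ∫ x, h x ∂D ≤ c) : ∫⁻ x, ENNReal.ofReal (g x) ∂D ≤ ENNReal.ofReal c := by
  calc ∫⁻ x, ENNReal.ofReal (g x) ∂D ≤ ∫⁻ x, ENNReal.ofReal (h x) ∂D :=
        lintegral_mono fun x => ENNReal.ofReal_le_ofReal (hgh x)
    _ = ENNReal.ofReal (∫ x, h x ∂D) :=
        (ofReal_integral_eq_lintegral_ofReal hh
          (Filter.Eventually.of_forall fun x => (hg x).trans (hgh x))).symm
    _ ≤ ENNReal.ofReal c := ENNReal.ofReal_le_ofReal hc

/-! ### Centred vectors, truncation and one-step estimates -/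

/-- A random vector with mean zero, finite second moment, and covariance at most the identity. -/
structure IsCenteredSubisotropic {E : Type*} [MeasurableSpace E] {d : ℕ} (D : Measure E)
    (Y : E → EuclideanSpace ℝ (Fin d)) : Prop where
  measurable : Measurable Y
  memLp : MemLp Y 2 D
  mean_inner : ∀ u, ∫ x, inner ℝ u (Y x) ∂D = 0
  second_moment : ∀ u, ∫ x, inner ℝ u (Y x) ^ 2 ∂D ≤ ‖u‖ ^ 2

/-- Replace vectors of norm more than `R` by `0`. -/
noncomputable def truncate {F : Type*} [NormedAddCommGroup F] (R : ℝ) (y : F) : F :=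
  if ‖y‖ ≤ R then y else 0

theorem norm_truncate_le {F : Type*} [NormedAddCommGroup F] {R : ℝ} (hR : 0 ≤ R) (y : F) :
    ‖truncate R y‖ ≤ R := by
  unfold truncate; split_ifs with h
  · exact h
  · simpa using hR

theorem norm_truncate_le_norm {F : Type*} [NormedAddCommGroup F] (R : ℝ) (y : F) :
    ‖truncate R y‖ ≤ ‖y‖ := by
  unfold truncate; split_ifs with h <;> simp

theorem measurable_truncate {F : Type*} [NormedAddCommGroup F] [MeasurableSpace F] [BorelSpace F]
    (R : ℝ) : Measurable (truncate R : F → F) :=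
  Measurable.ite (measurableSet_le measurable_norm measurable_const) measurable_id
    measurable_const

namespace IsCenteredSubisotropic

variable {E : Type*} [MeasurableSpace E] {d : ℕ} {D : Measure E}
  {Y : E → EuclideanSpace ℝ (Fin d)}

theorem integrable_sq_norm (h : IsCenteredSubisotropic D Y) :
    Integrable (fun x => ‖Y x‖ ^ 2) D :=
  (memLp_two_iff_integrable_sq_norm h.memLp.1).1 h.memLp

theorem integrable_sq_inner (h : IsCenteredSubisotropic D Y) (u : EuclideanSpace ℝ (Fin d)) :
    Integrable (fun x => inner ℝ u (Y x) ^ 2) D :=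
  (h.memLp.const_inner u).integrable_sq

theorem measurableSet_lt_norm (h : IsCenteredSubisotropic D Y) (R : ℝ) :
    MeasurableSet {x | R < ‖Y x‖} :=
  measurableSet_lt measurable_const h.measurable.norm

theorem integral_sq_norm_le (h : IsCenteredSubisotropic D Y) : ∫ x, ‖Y x‖ ^ 2 ∂D ≤ d := by
  have e : ∀ x, ‖Y x‖ ^ 2 = ∑ i : Fin d, inner ℝ (EuclideanSpace.single i (1 : ℝ)) (Y x) ^ 2 := by
    intro x
    rw [EuclideanSpace.norm_sq_eq]
    simp [EuclideanSpace.inner_single_left]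
  simp_rw [e]
  rw [integral_finsetSum _ fun i _ => h.integrable_sq_inner _]
  calc ∑ i : Fin d, ∫ x, inner ℝ (EuclideanSpace.single i (1 : ℝ)) (Y x) ^ 2 ∂D
      ≤ ∑ i : Fin d, (1 : ℝ) := Finset.sum_le_sum fun i _ => by
        simpa using h.second_moment (EuclideanSpace.single i (1 : ℝ))
    _ = d := by simp

open Matrix in
-- In an eigenbasis the form is a combination of squared coordinates of `Y` with weights `l m ^ k ≥
-- 0`, and each squared coordinate has mean at most 1.
theorem integral_form_pow_le (h : IsCenteredSubisotropic D Y) {A : Matrix (Fin d) (Fin d) ℝ}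
    (hA : A.IsHermitian) (hpos : ∀ v, 0 ≤ v ⬝ᵥ (A *ᵥ v)) (k : ℕ) :
    Integrable (fun x => (Y x).ofLp ⬝ᵥ (A ^ k *ᵥ (Y x).ofLp)) D ∧
    (∀ v, 0 ≤ v ⬝ᵥ (A ^ k *ᵥ v)) ∧
      ∫ x, (Y x).ofLp ⬝ᵥ (A ^ k *ᵥ (Y x).ofLp) ∂D ≤ (A ^ k).trace := by
  obtain ⟨l, U, hU, hU', hform, htrace⟩ := exists_spectral_resolution hA
  have hl : ∀ m, 0 ≤ l m := fun m =>
    le_eigenvalue_of_le_form hU' hform (L := 0) (fun v => by simpa using hpos v) m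
  have e1 : A ^ k = Polynomial.aeval A (Polynomial.X ^ k : Polynomial ℝ) := by simp
  have e2 : ∀ x m, ((Y x).ofLp ᵥ* U) m = inner ℝ (WithLp.toLp 2 (Uᵀ m)) (Y x) := by
    intro x m
    simp [vecMul, dotProduct, PiLp.inner_apply]
  have hn : ∀ m, ‖WithLp.toLp 2 (Uᵀ m)‖ ^ 2 = 1 := by
    intro m
    have := congrFun (congrFun hU' m) m
    rw [Matrix.mul_apply, Matrix.one_apply_eq] at this
    rw [EuclideanSpace.norm_sq_eq, ← this]
    refine Finset.sum_congr rfl fun i _ => ?_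
    simp [sq]
  rw [e1, htrace]
  simp_rw [hform, e2, Polynomial.eval_pow, Polynomial.eval_X]
  refine ⟨integrable_finsetSum _ fun m _ => (h.integrable_sq_inner _).mul_const _,
    fun v => Finset.sum_nonneg fun m _ => mul_nonneg (sq_nonneg _) (pow_nonneg (hl m) k), ?_⟩
  rw [integral_finsetSum _ fun m _ => (h.integrable_sq_inner _).mul_const _]
  refine Finset.sum_le_sum fun m _ => ?_
  rw [integral_mul_const]
  have := h.second_moment (WithLp.toLp 2 (Uᵀ m))
  rw [hn] at this
  exact mul_le_of_le_one_left (pow_nonneg (hl m) k) this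

variable [IsProbabilityMeasure D]

theorem integral_indicator_lt_norm_le (h : IsCenteredSubisotropic D Y) {R : ℝ} (hR : 0 < R) :
    ∫ x, Set.indicator {x | R < ‖Y x‖} 1 x ∂D ≤ d / R ^ 2 := by
  have hp : ∀ x, Set.indicator {x | R < ‖Y x‖} (1 : E → ℝ) x ≤ ‖Y x‖ ^ 2 / R ^ 2 := by
    intro x
    by_cases hx : R < ‖Y x‖
    · rw [Set.indicator_of_mem (by exact hx), Pi.one_apply, one_le_div (by positivity)]
      gcongr
    · rw [Set.indicator_of_notMem (by exact hx)]; positivity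
  have hi : Integrable (Set.indicator {x | R < ‖Y x‖} (1 : E → ℝ)) D :=
    (integrable_const (1 : ℝ)).indicator (h.measurableSet_lt_norm R)
  calc ∫ x, Set.indicator {x | R < ‖Y x‖} 1 x ∂D ≤ ∫ x, ‖Y x‖ ^ 2 / R ^ 2 ∂D :=
        integral_mono hi (h.integrable_sq_norm.div_const _) hp
    _ = (∫ x, ‖Y x‖ ^ 2 ∂D) / R ^ 2 := integral_div _ _
    _ ≤ d / R ^ 2 := by gcongr; exact h.integral_sq_norm_le

theorem integrable_inner_truncate (h : IsCenteredSubisotropic D Y) (R : ℝ)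
    (z : EuclideanSpace ℝ (Fin d)) : Integrable (fun x => inner ℝ z (truncate R (Y x))) D := by
  refine ((h.memLp.integrable (by norm_num)).norm.const_mul ‖z‖).mono'
    ((measurable_truncate R).comp h.measurable |>.const_inner).aestronglyMeasurable ?_
  filter_upwards with x
  refine (norm_inner_le_norm _ _).trans ?_
  gcongr
  exact norm_truncate_le_norm _ _

/-- Truncation moves the mean only a little. -/
theorem integral_inner_truncate_le (h : IsCenteredSubisotropic D Y) {R : ℝ} (hR : 0 < R)
    (z : EuclideanSpace ℝ (Fin d)) :
    ∫ x, inner ℝ z (truncate R (Y x)) ∂D ≤ ‖z‖ * (√d / R) := by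
  set s : ℝ := √d / R with hs
  have hs0 : 0 ≤ s := by positivity
  set I := Set.indicator {x | R < ‖Y x‖} (1 : E → ℝ) with hI
  have hIi : Integrable I D :=
    (integrable_const (1 : ℝ)).indicator (h.measurableSet_lt_norm R)
  have hq : ∫ x, I x ∂D ≤ s ^ 2 := by
    rw [hs, div_pow, Real.sq_sqrt (Nat.cast_nonneg d)]
    exact h.integral_indicator_lt_norm_le hR
  have hIY : Integrable (fun x => inner ℝ z (Y x)) D :=
    (h.memLp.const_inner z).integrable (by norm_num)
  -- Cauchy-Schwarz in its AM-GM form: where `Y` is cut, `-2⟨z, Y⟩ ≤ a⟨z, Y⟩² + a⁻¹`. The best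
  -- choice is `a = s / ‖z‖`.
  have key : ∀ a : ℝ, 0 < a →
      2 * ∫ x, inner ℝ z (truncate R (Y x)) ∂D ≤ a * ‖z‖ ^ 2 + a⁻¹ * s ^ 2 := by
    intro a ha
    have hp : ∀ x, 2 * inner ℝ z (truncate R (Y x)) ≤
        2 * inner ℝ z (Y x) + (a * inner ℝ z (Y x) ^ 2 + a⁻¹ * I x) := by
      intro x
      by_cases hx : R < ‖Y x‖
      · have h1 : I x = 1 := Set.indicator_of_mem (by exact hx) _
        rw [truncate, if_neg (not_le.2 hx), h1, inner_zero_right]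
        have h2 : 0 ≤ a⁻¹ * (a * inner ℝ z (Y x) + 1) ^ 2 := by positivity
        have h3 : a⁻¹ * (a * inner ℝ z (Y x) + 1) ^ 2 =
            a * inner ℝ z (Y x) ^ 2 + 2 * inner ℝ z (Y x) + a⁻¹ := by
          field_simp; ring
        linarith
      · have h1 : I x = 0 := Set.indicator_of_notMem (by exact hx) _
        rw [truncate, if_pos (not_lt.1 hx), h1]
        have : 0 ≤ a * inner ℝ z (Y x) ^ 2 := by positivity
        linarith
    have hint := integral_mono ((h.integrable_inner_truncate R z).const_mul 2)
      ((hIY.const_mul 2).add (((h.integrable_sq_inner z).const_mul a).add (hIi.const_mul a⁻¹))) hp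
    have hadd : Integrable (fun x => a * inner ℝ z (Y x) ^ 2 + a⁻¹ * I x) D :=
      ((h.integrable_sq_inner z).const_mul a).add (hIi.const_mul a⁻¹)
    rw [integral_const_mul] at hint
    simp only [Pi.add_apply] at hint
    rw [integral_add (hIY.const_mul 2) hadd, integral_add ((h.integrable_sq_inner z).const_mul a)
      (hIi.const_mul a⁻¹), integral_const_mul, integral_const_mul, integral_const_mul,
      h.mean_inner] at hint
    have h1 := mul_le_mul_of_nonneg_left (h.second_moment z) ha.le
    have h2 := mul_le_mul_of_nonneg_left hq (inv_nonneg.2 ha.le)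
    linarith
  rcases eq_or_lt_of_le (norm_nonneg z) with hz | hz
  · have : z = 0 := norm_eq_zero.1 hz.symm
    simp [this]
  rcases eq_or_lt_of_le hs0 with hs' | hs'
  · rw [← hs', mul_zero]
    by_contra hcon
    rw [not_le] at hcon
    set w := ∫ x, inner ℝ z (truncate R (Y x)) ∂D
    -- For `s = 0` there is no best `a`; this choice turns `key` into `2 w ≤ w` with `w > 0`.
    have := key (w / ‖z‖ ^ 2) (by positivity)
    rw [← hs', div_mul_cancel₀ _ (by positivity)] at this
    simp at this
    linarith
  · have := key (s / ‖z‖) (by positivity)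
    have e : s / ‖z‖ * ‖z‖ ^ 2 + (s / ‖z‖)⁻¹ * s ^ 2 = 2 * (‖z‖ * s) := by
      field_simp; ring
    linarith

theorem lintegral_exp_count_step (h : IsCenteredSubisotropic D Y) {R : ℝ} (hR : 0 < R) (z : ℝ) :
    ∫⁻ x, ENNReal.ofReal (Real.exp (z + Set.indicator {x | R < ‖Y x‖} 1 x)) ∂D ≤
      ENNReal.ofReal (1 + 2 * (d / R ^ 2)) * ENNReal.ofReal (Real.exp z) := by
  rw [← ENNReal.ofReal_mul (by positivity)]
  set I := Set.indicator {x | R < ‖Y x‖} (1 : E → ℝ) with hI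
  have hIi : Integrable I D :=
    (integrable_const (1 : ℝ)).indicator (h.measurableSet_lt_norm R)
  -- For an indicator, `exp I = 1 + (e - 1) I`, and `e - 1 ≤ 2`.
  refine lintegral_ofReal_le_of_le (h := fun x => Real.exp z + 2 * Real.exp z * I x)
    (fun x => (Real.exp_pos _).le) (fun x => ?_)
    ((integrable_const _).add (hIi.const_mul _)) ?_
  · rw [Real.exp_add]
    by_cases hx : R < ‖Y x‖
    · have h1 : I x = 1 := Set.indicator_of_mem (by exact hx) _
      rw [h1]
      nlinarith [Real.exp_one_lt_d9, Real.exp_pos z]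
    · have h1 : I x = 0 := Set.indicator_of_notMem (by exact hx) _
      simp [h1]
  · rw [integral_add (integrable_const _) (hIi.const_mul _), integral_const_mul]
    simp only [integral_const, probReal_univ, one_smul]
    have := h.integral_indicator_lt_norm_le hR
    nlinarith [Real.exp_pos z]

open Matrix in
theorem lintegral_trace_pow_step (h : IsCenteredSubisotropic D Y) {R L : ℝ} (hR : 0 ≤ R)
    (hL0 : 0 < L) {k : ℕ} (hk : k * R ^ 2 ≤ L) {A : Matrix (Fin d) (Fin d) ℝ}
    (hA : A.IsHermitian) (hL : ∀ v, L * (v ⬝ᵥ v) ≤ v ⬝ᵥ (A *ᵥ v)) :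
    ∫⁻ x, ENNReal.ofReal (((A + vecMulVec (truncate R (Y x)).ofLp
        (truncate R (Y x)).ofLp) ^ k).trace) ∂D ≤
      ENNReal.ofReal (1 + 3 * k / L) * ENNReal.ofReal ((A ^ k).trace) := by
  have hr : ∀ v : Fin d → ℝ, 0 ≤ v ⬝ᵥ v := fun v => by
    rw [dotProduct]; exact Finset.sum_nonneg fun _ _ => mul_self_nonneg _
  have hpos : ∀ v, 0 ≤ v ⬝ᵥ (A *ᵥ v) := fun v => (mul_nonneg hL0.le (hr v)).trans (hL v)
  rw [← ENNReal.ofReal_mul (by positivity)]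
  obtain ⟨hint, hform, hle⟩ := h.integral_form_pow_le hA hpos k
  have hle' : ∀ x, ((A + vecMulVec (truncate R (Y x)).ofLp (truncate R (Y x)).ofLp) ^ k).trace ≤
      (A ^ k).trace + 3 * k / L * ((Y x).ofLp ⬝ᵥ (A ^ k *ᵥ (Y x).ofLp)) := by
    intro x
    have hnorm : (truncate R (Y x)).ofLp ⬝ᵥ (truncate R (Y x)).ofLp ≤ R ^ 2 := by
      have := norm_truncate_le hR (Y x)
      calc _ = ‖truncate R (Y x)‖ ^ 2 := by
            rw [EuclideanSpace.norm_sq_eq]; simp [dotProduct, sq]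
        _ ≤ R ^ 2 := by gcongr
    refine (trace_rankOne_pow_le hA hL0 hL _ k ((mul_le_mul_of_nonneg_left hnorm
      (Nat.cast_nonneg k)).trans hk)).trans ?_
    gcongr
    -- A cut vector contributes 0, which is no more than the nonnegative form at `Y x`.
    unfold truncate
    split_ifs
    · exact le_rfl
    · simpa using hform _
  calc _ ≤ ∫⁻ x, ENNReal.ofReal ((A ^ k).trace +
          3 * k / L * ((Y x).ofLp ⬝ᵥ (A ^ k *ᵥ (Y x).ofLp))) ∂D :=
        lintegral_mono fun x => ENNReal.ofReal_le_ofReal (hle' x)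
    _ ≤ _ := by
      have htr : 0 ≤ (A ^ k).trace := by
        rw [Matrix.trace]
        refine Finset.sum_nonneg fun i _ => ?_
        have := hform (Pi.single i 1)
        simpa using this
      refine lintegral_ofReal_le_of_le (fun x => ?_) (fun x => le_rfl)
        ((integrable_const _).add (hint.const_mul _)) ?_
      · have := hform (Y x).ofLp
        positivity
      · rw [integral_add (integrable_const _) (hint.const_mul _), integral_const_mul]
        simp only [integral_const, probReal_univ, one_smul]
        have := mul_le_mul_of_nonneg_left hle (show 0 ≤ 3 * k / L by positivity)
        linarith

end IsCenteredSubisotropic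

/-! ### The potential for norms of sums -/

/-- Here `s = ‖z‖`, `t = ⟨z, y⟩` and `v = ‖y‖` for an increment `y`. The size condition on `L` makes
`k` times the relative increment at most 1, where `exp y ≤ 1 + y + y²`. The linear term in `t` is
kept exactly, because its mean is only the truncation bias; `t²` costs `v² / L` because `s² ≤ a`.
The constant 11 is 10 from the square plus 1 from the linear term in `v²`. -/
theorem add_pow_le_of_small {L R a s t v : ℝ} {k : ℕ} (hk : 1 ≤ k) (hL0 : 0 < L)
    (hL : 16 * k ^ 2 * R ^ 2 ≤ L) (ha : a = L + s ^ 2) (hv : 0 ≤ v) (hvR : v ≤ R)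
    (ht : |t| ≤ s * v) :
    (a + (2 * t + v ^ 2)) ^ k ≤ a ^ k * (1 + 2 * k / a * t + 11 * k ^ 2 / L * v ^ 2) := by
  have hk1 : (1 : ℝ) ≤ k := by exact_mod_cast hk
  have ha0 : 0 < a := by rw [ha]; positivity
  have hLa : L ≤ a := by rw [ha]; nlinarith
  have hR : 0 ≤ R := hv.trans hvR
  obtain ⟨ht1, ht2⟩ := abs_le.1 ht
  have hkv : (k * v) ^ 2 ≤ L / 16 := by
    have : (k * v) ^ 2 ≤ (k * R) ^ 2 := by gcongr
    nlinarith
  have hy : |k * ((2 * t + v ^ 2) / a)| ≤ 1 := by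
    have e : k * ((2 * t + v ^ 2) / a) = (k * (2 * t + v ^ 2)) / a := by ring
    have hb : k * (2 * (s * v) + v ^ 2) ≤ a := by
      have h1 : 2 * s * (k * v) ≤ s ^ 2 + (k * v) ^ 2 := by nlinarith [sq_nonneg (s - k * v)]
      have h2 : k * v ^ 2 ≤ (k * v) ^ 2 := by
        rw [mul_pow]; exact mul_le_mul_of_nonneg_right (by nlinarith) (sq_nonneg _)
      rw [ha]; nlinarith
    rw [e, abs_div, abs_of_pos ha0, div_le_one ha0, abs_mul, abs_of_pos (by linarith : (0 : ℝ) < k)]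
    refine le_trans (mul_le_mul_of_nonneg_left ?_ (by linarith)) hb
    rw [abs_le]; constructor <;> nlinarith [sq_nonneg v]
  set x := (2 * t + v ^ 2) / a with hx
  have hbase : a + (2 * t + v ^ 2) = a * (1 + x) := by rw [hx]; field_simp
  have hx1 : |x| ≤ 1 := by
    rw [abs_mul, abs_of_pos (by linarith : (0 : ℝ) < k)] at hy
    nlinarith [abs_nonneg x]
  have hx0 : 0 ≤ 1 + x := by linarith [(abs_le.1 hx1).1]
  rw [hbase, mul_pow]
  refine mul_le_mul_of_nonneg_left ?_ (pow_nonneg ha0.le _)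
  have h1 : (1 + x) ^ k ≤ Real.exp (k * x) := by
    rw [Real.exp_nat_mul]
    exact pow_le_pow_left₀ hx0 (by linarith [Real.add_one_le_exp x]) _
  have h2 : Real.exp (k * x) ≤ 1 + k * x + (k * x) ^ 2 := by
    linarith [(abs_le.1 (Real.abs_exp_sub_one_sub_id_le hy)).2]
  have h3 : x ^ 2 ≤ 10 / L * v ^ 2 := by
    rw [hx, div_pow, div_mul_eq_mul_div, div_le_div_iff₀ (by positivity) hL0]
    have h4 : (2 * t + v ^ 2) ^ 2 ≤ v ^ 2 * (8 * s ^ 2 + 2 * v ^ 2) := by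
      have : |2 * t + v ^ 2| ≤ v * (2 * s + v) := by
        rw [abs_le]; constructor <;> nlinarith
      calc (2 * t + v ^ 2) ^ 2 ≤ (v * (2 * s + v)) ^ 2 := sq_le_sq' (abs_le.1 this).1 (abs_le.1 this).2
        _ ≤ _ := by
          rw [mul_pow]
          exact mul_le_mul_of_nonneg_left (by nlinarith [sq_nonneg (2 * s - v)]) (sq_nonneg _)
    have h5 : 8 * s ^ 2 + 2 * v ^ 2 ≤ 8 * a := by
      have : v ^ 2 ≤ (k * v) ^ 2 := by gcongr; nlinarith
      rw [ha]; nlinarith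
    have h6 : v ^ 2 * (8 * s ^ 2 + 2 * v ^ 2) ≤ v ^ 2 * (8 * a) :=
      mul_le_mul_of_nonneg_left h5 (sq_nonneg _)
    calc (2 * t + v ^ 2) ^ 2 * L ≤ (v ^ 2 * (8 * a)) * a :=
          mul_le_mul (h4.trans h6) hLa hL0.le (by positivity)
      _ ≤ 10 * v ^ 2 * a ^ 2 := by nlinarith [mul_nonneg (sq_nonneg v) (sq_nonneg a)]
  have h7 : k * (v ^ 2 / a) ≤ k ^ 2 / L * v ^ 2 := by
    calc k * (v ^ 2 / a) ≤ k ^ 2 * (v ^ 2 / L) := by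
          gcongr
          nlinarith
      _ = _ := by ring
  have h8 : (k * x) ^ 2 ≤ 10 * k ^ 2 / L * v ^ 2 := by
    calc (k * x) ^ 2 = k ^ 2 * x ^ 2 := by ring
      _ ≤ k ^ 2 * (10 / L * v ^ 2) := by gcongr
      _ = _ := by ring
  have h9 : k * x = 2 * k / a * t + k * (v ^ 2 / a) := by rw [hx]; ring
  have h10 : 11 * k ^ 2 / L * v ^ 2 = k ^ 2 / L * v ^ 2 + 10 * k ^ 2 / L * v ^ 2 := by ring
  linarith

theorem IsCenteredSubisotropic.lintegral_norm_pow_step {E : Type*} [MeasurableSpace E] {d : ℕ}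
    {D : Measure E} [IsProbabilityMeasure D] {Y : E → EuclideanSpace ℝ (Fin d)}
    (h : IsCenteredSubisotropic D Y) {R L : ℝ} (hR : 0 < R) (hL0 : 0 < L) {k : ℕ} (hk : 1 ≤ k)
    (hL : 16 * k ^ 2 * R ^ 2 ≤ L) (z : EuclideanSpace ℝ (Fin d)) :
    ∫⁻ x, ENNReal.ofReal ((L + ‖z + truncate R (Y x)‖ ^ 2) ^ k) ∂D ≤
      ENNReal.ofReal (1 + (2 * k * (√d / R) / √L + 11 * k ^ 2 * d / L)) *
        ENNReal.ofReal ((L + ‖z‖ ^ 2) ^ k) := by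
  rw [← ENNReal.ofReal_mul (by positivity)]
  set a := L + ‖z‖ ^ 2 with ha
  have ha0 : 0 < a := by positivity
  have hi1 := h.integrable_inner_truncate R z
  have hi2 := h.integrable_sq_norm
  refine lintegral_ofReal_le_of_le (h := fun x => a ^ k * (1 +
    2 * k / a * inner ℝ z (truncate R (Y x)) + 11 * k ^ 2 / L * ‖Y x‖ ^ 2))
    (fun x => by positivity) (fun x => ?_)
    ((((integrable_const _).add (hi1.const_mul _)).add (hi2.const_mul _)).const_mul _) ?_
  · have e : L + ‖z + truncate R (Y x)‖ ^ 2 =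
        a + (2 * inner ℝ z (truncate R (Y x)) + ‖truncate R (Y x)‖ ^ 2) := by
      rw [norm_add_sq_real]; ring
    rw [e]
    refine (add_pow_le_of_small hk hL0 hL ha (norm_nonneg _)
      (norm_truncate_le hR.le _) (abs_real_inner_le_norm _ _)).trans ?_
    gcongr
    exact norm_truncate_le_norm _ _
  · have hadd : Integrable (fun x => 1 + 2 * k / a * inner ℝ z (truncate R (Y x))) D :=
      (integrable_const _).add (hi1.const_mul _)
    rw [integral_const_mul, integral_add hadd (hi2.const_mul _), integral_add (integrable_const _) (hi1.const_mul _), integral_const_mul,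
      integral_const_mul, mul_comm]
    refine mul_le_mul_of_nonneg_right ?_ (pow_nonneg ha0.le _)
    simp only [integral_const, probReal_univ, one_smul, add_assoc]
    refine add_le_add_right (add_le_add ?_ ?_) _
    -- AM-GM for `a = L + ‖z‖²`: the relative drift stays bounded however large `z` is.
    · have h1 : ‖z‖ / a ≤ 1 / √L := by
        have h2 : ‖z‖ * √L ≤ a := by
          have := Real.sq_sqrt hL0.le
          nlinarith [sq_nonneg (‖z‖ - √L), sq_nonneg ‖z‖]
        rw [div_le_div_iff₀ ha0 (by positivity)]; linarith
      calc 2 * k / a * ∫ x, inner ℝ z (truncate R (Y x)) ∂D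
          ≤ 2 * k / a * (‖z‖ * (√d / R)) := by
            gcongr; exact h.integral_inner_truncate_le hR z
        _ = 2 * k * (√d / R) * (‖z‖ / a) := by ring
        _ ≤ 2 * k * (√d / R) * (1 / √L) := by gcongr
        _ = _ := by ring
    · calc 11 * k ^ 2 / L * ∫ x, ‖Y x‖ ^ 2 ∂D ≤ 11 * k ^ 2 / L * d := by
            gcongr; exact h.integral_sq_norm_le
        _ = _ := by ring

/-! ### Tail bounds for independent vectors -/

section Concentration

theorem meas_lt_le_of_lintegral_ofReal_le {Ω : Type*} [MeasurableSpace Ω] {P : Measure Ω}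
    {g : Ω → ℝ} (hg : Measurable g) {B t : ℝ} (ht : 0 < t)
    (h : ∫⁻ x, ENNReal.ofReal (g x) ∂P ≤ ENNReal.ofReal B) :
    P {x | t < g x} ≤ ENNReal.ofReal (B / t) := by
  rw [ENNReal.ofReal_div_of_pos ht]
  calc P {x | t < g x} ≤ P {x | ENNReal.ofReal t ≤ ENNReal.ofReal (g x)} :=
        measure_mono fun x hx => ENNReal.ofReal_le_ofReal (le_of_lt hx)
    _ ≤ (∫⁻ x, ENNReal.ofReal (g x) ∂P) / ENNReal.ofReal t :=
        meas_ge_le_lintegral_div hg.ennreal_ofReal.aemeasurable (by simpa using ht)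
          ENNReal.ofReal_ne_top
    _ ≤ _ := by gcongr

theorem one_add_pow_le_exp {a b : ℝ} {N : ℕ} (ha : 0 ≤ a) (h : N * a ≤ b) :
    (1 + a) ^ N ≤ Real.exp b := by
  calc (1 + a) ^ N ≤ Real.exp a ^ N :=
        pow_le_pow_left₀ (by linarith) (by linarith [Real.add_one_le_exp a]) _
    _ = Real.exp (N * a) := (Real.exp_nat_mul _ _).symm
    _ ≤ _ := Real.exp_le_exp.2 h

variable {E : Type*} [MeasurableSpace E] {d N : ℕ} {ν : Fin N → Measure E}
  [∀ i, IsProbabilityMeasure (ν i)] {Y : Fin N → E → EuclideanSpace ℝ (Fin d)}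

theorem measure_pi_count_le (h : ∀ i, IsCenteredSubisotropic (ν i) (Y i)) {R : ℝ} (hR : 0 < R)
    (m : ℝ) :
    Measure.pi ν {x | m < ∑ i, Set.indicator {y | R < ‖Y i y‖} (1 : E → ℝ) (x i)} ≤
      ENNReal.ofReal (Real.exp (N * (2 * (d / R ^ 2)) - m)) := by
  have hmeas : Measurable fun x : Fin N → E =>
      ∑ i, Set.indicator {y | R < ‖Y i y‖} (1 : E → ℝ) (x i) :=
    Finset.measurable_fun_sum _ fun i _ =>
      (measurable_one.indicator ((h i).measurableSet_lt_norm R)).comp (measurable_pi_apply i)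
  have hint := lintegral_pi_add_sum_le (V := Set.univ) (Ψ := fun z => ENNReal.ofReal (Real.exp z))
    ENNReal.ofReal_ne_top ν (fun i => Set.indicator {y | R < ‖Y i y‖} (1 : E → ℝ))
    (fun _ _ _ _ => Set.mem_univ _) (fun i z _ => (h i).lintegral_exp_count_step hR z) 0
    (Set.mem_univ _)
  simp only [zero_add, Real.exp_zero, ENNReal.ofReal_one, mul_one] at hint
  rw [← ENNReal.ofReal_pow (by positivity)] at hint
  have := meas_lt_le_of_lintegral_ofReal_le (Real.measurable_exp.comp hmeas)
    (Real.exp_pos m) hint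
  calc _ ≤ _ := measure_mono fun x hx => by exact Real.exp_lt_exp.2 hx
    _ ≤ _ := this
    _ ≤ _ := by
      refine ENNReal.ofReal_le_ofReal ?_
      rw [Real.exp_sub]
      gcongr
      exact one_add_pow_le_exp (by positivity) le_rfl

open Matrix in
/-- `L • I + ∑ v vᵀ` over the truncated examples `v`. -/
noncomputable def truncatedGram {d N : ℕ} (R L : ℝ) (y : Dataset d N) :
    Matrix (Fin d) (Fin d) ℝ :=
  L • 1 + ∑ i, vecMulVec (truncate R (y i)).ofLp (truncate R (y i)).ofLp

theorem measurable_trace_truncatedGram_pow (R L : ℝ) (k : ℕ) :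
    Measurable fun y : Dataset d N => ((truncatedGram R L y) ^ k).trace := by
  have hc : Continuous fun v : Dataset d N =>
      ((L • (1 : Matrix (Fin d) (Fin d) ℝ) +
        ∑ i, Matrix.vecMulVec (v i).ofLp (v i).ofLp) ^ k).trace := by
    fun_prop
  have hm : Measurable fun y : Dataset d N => fun i => truncate R (y i) :=
    measurable_pi_lambda _ fun i => (measurable_truncate R).comp (measurable_pi_apply i)
  exact hc.measurable.comp hm

open Matrix in
-- The potential starts at `d L^k` and its mean grows by at most `(1 + 3k/L)^N ≤ e^(3k)`. The
-- threshold `e^(6k) L^k` leaves `d e^(-3k)`.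
theorem measure_pi_trace_le (h : ∀ i, IsCenteredSubisotropic (ν i) (Y i)) {R L : ℝ} (hR : 0 ≤ R)
    (hL0 : 0 < L) {k : ℕ} (hk : k * R ^ 2 ≤ L) (hN : N ≤ L) :
    Measure.pi ν {x | (Real.exp 6 * L) ^ k <
        ((truncatedGram R L fun i => Y i (x i)) ^ k).trace} ≤
      ENNReal.ofReal (d * Real.exp (-(3 * k))) := by
  have hint := lintegral_pi_add_sum_le
    (V := {A : Matrix (Fin d) (Fin d) ℝ | A.IsHermitian ∧
      ∀ v, L * (v ⬝ᵥ v) ≤ v ⬝ᵥ (A *ᵥ v)})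
    (Ψ := fun A => ENNReal.ofReal ((A ^ k).trace)) ENNReal.ofReal_ne_top ν
    (fun i x => vecMulVec (truncate R (Y i x)).ofLp (truncate R (Y i x)).ofLp)
    (fun i A hA x => ?_)
    (fun i A hA => (h i).lintegral_trace_pow_step hR hL0 hk hA.1 hA.2) (L • 1) ?_
  rotate_left
  · refine ⟨hA.1.add ?_, fun v => ?_⟩
    · ext a b; simp [vecMulVec_apply, mul_comm]
    · rw [add_mulVec, dotProduct_add, vecMulVec_mulVec, op_smul_eq_smul, dotProduct_smul,
        smul_eq_mul, dotProduct_comm v (truncate R (Y i x)).ofLp]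
      have := hA.2 v
      nlinarith [mul_self_nonneg ((truncate R (Y i x)).ofLp ⬝ᵥ v)]
  · refine ⟨?_, fun v => ?_⟩
    · ext a b; simp [Matrix.one_apply, eq_comm]
    · simp [smul_mulVec]
  have htr : (((L • 1 : Matrix (Fin d) (Fin d) ℝ)) ^ k).trace = L ^ k * d := by
    rw [smul_pow, one_pow, trace_smul, trace_one]; simp
  rw [htr, ← ENNReal.ofReal_pow (by positivity), ← ENNReal.ofReal_mul (by positivity)] at hint
  have hY : Measurable fun x : Fin N → E => fun i => Y i (x i) :=
    measurable_pi_lambda _ fun i => (h i).measurable.comp (measurable_pi_apply i)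
  refine (meas_lt_le_of_lintegral_ofReal_le
    (g := fun x : Fin N → E => ((truncatedGram R L fun i => Y i (x i)) ^ k).trace)
    ((measurable_trace_truncatedGram_pow R L k).comp hY)
    (by positivity) hint).trans (ENNReal.ofReal_le_ofReal ?_)
  have h1 : (1 + 3 * k / L) ^ N ≤ Real.exp (3 * k) := by
    refine one_add_pow_le_exp (by positivity) ?_
    rw [mul_div_assoc', div_le_iff₀ hL0]
    nlinarith [mul_le_mul_of_nonneg_right hN (Nat.cast_nonneg (α := ℝ) k)]
  have h2 : Real.exp 6 ^ k = Real.exp (3 * k) * Real.exp (3 * k) := by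
    rw [← Real.exp_nat_mul, ← Real.exp_add]; congr 1; ring
  rw [div_le_iff₀ (by positivity), mul_pow, h2, Real.exp_neg]
  calc (1 + 3 * k / L) ^ N * (L ^ k * d) ≤ Real.exp (3 * k) * (L ^ k * d) := by gcongr
    _ = _ := by field_simp

/-- The lower bounds on `L` pay for the size of a single jump, the total variance and the
accumulated truncation bias. Growth is at most `e^(2k + 11k)`, so the factor `e^16` leaves
`e^(-3k)`. The predicate `p` selects the examples with a given coordinate present; the others add 0.
-/
theorem measure_pi_norm_sum_le (h : ∀ i, IsCenteredSubisotropic (ν i) (Y i)) {R L : ℝ}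
    (hR : 0 < R) (hL0 : 0 < L) {k : ℕ} (hk : 1 ≤ k) (hL1 : 16 * k ^ 2 * R ^ 2 ≤ L)
    (hL2 : k * d * N ≤ L) (hL3 : N * (√d / R) ≤ √L) (p : Fin N → Prop) [DecidablePred p] :
    Measure.pi ν {x | Real.exp 16 * L <
        ‖∑ i, if p i then truncate R (Y i (x i)) else 0‖ ^ 2} ≤
      ENNReal.ofReal (Real.exp (-(3 * k))) := by
  have hk0 : k ≠ 0 := by omega
  have hint := lintegral_pi_add_sum_le (V := Set.univ)
    (Ψ := fun z : EuclideanSpace ℝ (Fin d) => ENNReal.ofReal ((L + ‖z‖ ^ 2) ^ k))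
    (c := ENNReal.ofReal (1 + (2 * k * (√d / R) / √L + 11 * k ^ 2 * d / L)))
    ENNReal.ofReal_ne_top ν (fun i x => if p i then truncate R (Y i x) else 0)
    (fun _ _ _ _ => Set.mem_univ _) (fun i z _ => ?_) 0 (Set.mem_univ _)
  swap
  · by_cases hp : p i
    · simp only [hp, if_true]
      exact (h i).lintegral_norm_pow_step hR hL0 hk hL1 z
    · simp only [hp, if_false, add_zero, lintegral_const, measure_univ, mul_one]
      refine le_mul_of_one_le_left zero_le ?_
      rw [← ENNReal.ofReal_one]
      refine ENNReal.ofReal_le_ofReal (le_add_of_nonneg_right (by positivity))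
  simp only [zero_add, norm_zero, ne_eq, OfNat.ofNat_ne_zero, not_false_eq_true, zero_pow,
    add_zero] at hint
  rw [← ENNReal.ofReal_pow (by positivity), ← ENNReal.ofReal_mul (by positivity)] at hint
  have hmeas : Measurable fun x : Fin N → E =>
      ∑ i, if p i then truncate R (Y i (x i)) else 0 := by
    refine Finset.measurable_fun_sum _ fun i _ => ?_
    by_cases hp : p i
    · simp only [hp, if_true]
      exact (measurable_truncate R).comp ((h i).measurable.comp (measurable_pi_apply i))
    · simp only [hp, if_false]; exact measurable_const
  have hM := meas_lt_le_of_lintegral_ofReal_le (t := (Real.exp 16 * L) ^ k)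
    (((hmeas.norm.pow_const 2).const_add L).pow_const k) (by positivity) hint
  calc _ ≤ _ := measure_mono fun x hx => by
        exact pow_lt_pow_left₀ (lt_of_lt_of_le hx (le_add_of_nonneg_left hL0.le))
          (by positivity) hk0
    _ ≤ _ := hM
    _ ≤ _ := ENNReal.ofReal_le_ofReal ?_
  have h1 : (1 + (2 * k * (√d / R) / √L + 11 * k ^ 2 * d / L)) ^ N ≤ Real.exp (13 * k) := by
    refine one_add_pow_le_exp (by positivity) ?_
    have e1 : N * (2 * k * (√d / R) / √L) ≤ 2 * k := by
      rw [mul_div_assoc', div_le_iff₀ (by positivity)]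
      have hk' : (0 : ℝ) ≤ k := Nat.cast_nonneg k
      nlinarith
    have e2 : N * (11 * k ^ 2 * d / L) ≤ 11 * k := by
      rw [mul_div_assoc', div_le_iff₀ hL0]
      have hk' : (0 : ℝ) ≤ k := Nat.cast_nonneg k
      nlinarith
    rw [mul_add]; linarith
  have h2 : Real.exp 16 ^ k = Real.exp (13 * k) * Real.exp (3 * k) := by
    rw [← Real.exp_nat_mul, ← Real.exp_add]; congr 1; ring
  rw [div_le_iff₀ (by positivity), mul_pow, h2, Real.exp_neg]
  calc _ ≤ Real.exp (13 * k) * L ^ k := by gcongr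
    _ = _ := by field_simp

end Concentration

/-! ### From uniform moment bounds to all bounded weights -/

section Deterministic

/-- Bounded weights are close to the uniform ones. -/
theorem boundedWeights_sub_uniform {N : ℕ} {G : Finset (Fin N)} {ε : ℝ} (hN : 0 < N) (hε : 0 < ε)
    (hε' : 11 * ε ≤ 1) {w : Fin N → ℝ} (hw : w ∈ boundedWeights G ((1 - 3 * (1.1 * ε)) * N)) :
    (∀ i, w i ≤ 2 / N) ∧ (∀ i, |w i - 1 / N| ≤ 2 / N) ∧ ∑ i, |w i - 1 / N| ≤ 10 * ε := by
  obtain ⟨h0, h1, -, hle⟩ := hw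
  have hN' : (0 : ℝ) < N := by exact_mod_cast hN
  have hp : 0.7 ≤ 1 - 3 * (1.1 * ε) := by linarith
  -- `(1 + 5ε)(1 - 3.3ε) ≥ 1` holds for `ε ≤ 1/11`.
  have hupper : 1 / ((1 - 3 * (1.1 * ε)) * N) ≤ (1 + 5 * ε) / N := by
    rw [div_le_div_iff₀ (by positivity) hN']
    have : 1 ≤ (1 + 5 * ε) * (1 - 3 * (1.1 * ε)) := by nlinarith
    nlinarith
  have hwi : ∀ i, w i ≤ (1 + 5 * ε) / N := fun i => (hle i).trans hupper
  have h2 : (1 + 5 * ε) / N ≤ 2 / N := by gcongr; linarith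
  have h3 : (0 : ℝ) < 1 / N := by positivity
  have h4 : (2 : ℝ) / N = 2 * (1 / N) := by ring
  refine ⟨fun i => (hwi i).trans h2, fun i => ?_, ?_⟩
  · rw [abs_le]; constructor
    · linarith [h0 i]
    · linarith [hwi i]
  -- `|x| = 2 x⁺ - x`, and the deviations sum to 0: an upper bound on the weights controls the `ℓ¹`
  -- distance, including the zero weights off `G`.
  · have hb : ∀ i, |w i - 1 / N| ≤ 2 * (5 * ε / N) - (w i - 1 / N) := by
      intro i
      have := hwi i
      rw [add_div] at this
      have : 0 < 5 * ε / N := by positivity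
      rw [abs_le]; constructor <;> linarith
    refine (Finset.sum_le_sum fun i _ => hb i).trans ?_
    rw [Finset.sum_sub_distrib, Finset.sum_sub_distrib, h1]
    simp only [Finset.sum_const, Finset.card_univ, Fintype.card_fin, nsmul_eq_mul]
    have e1 : (N : ℝ) * (2 * (5 * ε / N)) = 10 * ε := by field_simp; ring
    have e2 : (N : ℝ) * (1 / N) = 1 := by field_simp
    rw [e1, e2]; linarith

variable {N : ℕ} {F : Type*} [NormedAddCommGroup F] [InnerProductSpace ℝ F]

/-- A weighted sum with nearly uniform weights is close to the average, if the second moments are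
bounded. -/
theorem norm_weighted_sum_le {v : Fin N → F} {q : Fin N → Prop} [DecidablePred q] {w : Fin N → ℝ}
    {ε a b : ℝ} (hN : 0 < N) (hε : 0 < ε) (ha : 0 ≤ a)
    (hw : ∀ i, |w i - 1 / N| ≤ 2 / N) (hw1 : ∑ i, |w i - 1 / N| ≤ 10 * ε)
    (hv : ∀ u : F, ∑ i, inner ℝ u (v i) ^ 2 ≤ N * a ^ 2 * ‖u‖ ^ 2)
    (hsum : ‖∑ i, if q i then v i else 0‖ ≤ N * (b * √ε)) :
    ‖∑ i, if q i then w i • v i else 0‖ ≤ (b + 5 * a) * √ε := by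
  have hN' : (0 : ℝ) < N := by exact_mod_cast hN
  set c : Fin N → ℝ := fun i => if q i then w i - 1 / N else 0 with hc
  have hc1 : ∀ i, |c i| ≤ |w i - 1 / N| := by
    intro i; simp only [hc]; split_ifs <;> simp
  set z := ∑ i, c i • v i with hz
  have hsplit : (∑ i, if q i then w i • v i else 0) =
      z + (1 / N : ℝ) • ∑ i, if q i then v i else 0 := by
    rw [hz, Finset.smul_sum, ← Finset.sum_add_distrib]
    refine Finset.sum_congr rfl fun i _ => ?_
    simp only [hc]
    split_ifs
    · rw [← add_smul]; simp
    · simp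
  -- Pairing `z` with itself and applying Cauchy-Schwarz with weights `|c i|` gives `‖z‖² ≤ 20 ε
  -- a²`.
  have hz2 : (‖z‖ ^ 2) ^ 2 ≤ (10 * ε) * ((2 / N) * (N * a ^ 2 * ‖z‖ ^ 2)) := by
    have e : ‖z‖ ^ 2 = ∑ i, c i * inner ℝ z (v i) := by
      rw [← real_inner_self_eq_norm_sq]
      nth_rewrite 2 [hz]
      rw [inner_sum]
      simp [inner_smul_right]
    rw [e]
    refine (Finset.sum_sq_le_sum_mul_sum_of_sq_le_mul _ (f := fun i => |c i|)
      (g := fun i => |c i| * inner ℝ z (v i) ^ 2) (fun i _ => abs_nonneg _)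
      (fun i _ => mul_nonneg (abs_nonneg _) (sq_nonneg _)) fun i _ => ?_).trans ?_
    · refine le_of_eq ?_
      rw [mul_pow, ← sq_abs (c i)]; ring
    rw [← e]
    refine mul_le_mul ((Finset.sum_le_sum fun i _ => hc1 i).trans hw1) ?_
      (Finset.sum_nonneg fun i _ => mul_nonneg (abs_nonneg _) (sq_nonneg _)) (by positivity)
    calc ∑ i, |c i| * inner ℝ z (v i) ^ 2 ≤ ∑ i, 2 / N * inner ℝ z (v i) ^ 2 :=
          Finset.sum_le_sum fun i _ =>
            mul_le_mul_of_nonneg_right ((hc1 i).trans (hw i)) (sq_nonneg _)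
      _ = 2 / N * ∑ i, inner ℝ z (v i) ^ 2 := by rw [Finset.mul_sum]
      _ ≤ _ := by gcongr; exact hv z
  have hz3 : ‖z‖ ≤ 5 * a * √ε := by
    have h1 : (10 * ε) * ((2 / N) * (N * a ^ 2 * ‖z‖ ^ 2)) = 20 * ε * a ^ 2 * ‖z‖ ^ 2 := by
      field_simp; ring
    rw [h1] at hz2
    have h2 : ‖z‖ ^ 2 ≤ 20 * ε * a ^ 2 := by
      rcases eq_or_lt_of_le (sq_nonneg ‖z‖) with h | h
      · rw [← h]; positivity
      · nlinarith
    refine le_of_pow_le_pow_left₀ two_ne_zero (by positivity) ?_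
    rw [mul_pow, Real.sq_sqrt hε.le]
    nlinarith [mul_nonneg hε.le (sq_nonneg a)]
  rw [hsplit]
  refine (norm_add_le _ _).trans ?_
  rw [norm_smul, Real.norm_of_nonneg (by positivity)]
  have h4 : 1 / (N : ℝ) * ‖∑ i, if q i then v i else 0‖ ≤ b * √ε := by
    rw [one_div, inv_mul_le_iff₀ hN']; exact hsum
  linarith

open Matrix in
-- Cauchy-Schwarz for the weighted bilinear form, tested at `x` and `y = M x`.
theorem opNorm_weighted_gram_le {d : ℕ} {v : Fin N → EuclideanSpace ℝ (Fin d)} {G : Finset (Fin N)}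
    {w : Fin N → ℝ} {c : ℝ} (hw0 : ∀ i, 0 ≤ w i) (hc : 0 ≤ c)
    (hv : ∀ u, ∑ i ∈ G, w i * inner ℝ u (v i) ^ 2 ≤ c * ‖u‖ ^ 2) :
    opNorm (∑ i ∈ G, w i • vecMulVec (v i).ofLp (v i).ofLp) ≤ c := by
  set M := ∑ i ∈ G, w i • vecMulVec (v i).ofLp (v i).ofLp with hM
  have hinner : ∀ x y : EuclideanSpace ℝ (Fin d), inner ℝ y (toEuclideanCLM (𝕜 := ℝ) M x) =
      ∑ i ∈ G, w i * (inner ℝ y (v i) * inner ℝ x (v i)) := by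
    intro x y
    rw [inner_toEuclideanCLM, hM, Matrix.sum_mulVec, dotProduct_sum]
    refine Finset.sum_congr rfl fun i _ => ?_
    rw [smul_mulVec, dotProduct_smul, vecMulVec_mulVec, op_smul_eq_smul, dotProduct_smul,
      EuclideanSpace.inner_eq_star_dotProduct, EuclideanSpace.inner_eq_star_dotProduct]
    simp only [star_trivial, smul_eq_mul]
    rw [dotProduct_comm y.ofLp]
    ring
  refine ContinuousLinearMap.opNorm_le_bound _ hc fun x => ?_
  set y := toEuclideanCLM (𝕜 := ℝ) M x with hy
  have h1 : (‖y‖ ^ 2) ^ 2 ≤ (c * ‖y‖ ^ 2) * (c * ‖x‖ ^ 2) := by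
    have e : ‖y‖ ^ 2 = ∑ i ∈ G, w i * (inner ℝ y (v i) * inner ℝ x (v i)) := by
      rw [← real_inner_self_eq_norm_sq]; exact hinner x y
    nth_rewrite 1 [e]
    refine (Finset.sum_sq_le_sum_mul_sum_of_sq_le_mul _
      (f := fun i => w i * inner ℝ y (v i) ^ 2) (g := fun i => w i * inner ℝ x (v i) ^ 2)
      (fun i _ => mul_nonneg (hw0 i) (sq_nonneg _))
      (fun i _ => mul_nonneg (hw0 i) (sq_nonneg _)) fun i _ => le_of_eq (by ring)).trans ?_
    exact mul_le_mul (hv y) (hv x)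
      (Finset.sum_nonneg fun i _ => mul_nonneg (hw0 i) (sq_nonneg _)) (by positivity)
  refine le_of_pow_le_pow_left₀ two_ne_zero (by positivity) ?_
  rcases eq_or_lt_of_le (sq_nonneg ‖y‖) with h | h
  · rw [← h]; positivity
  · nlinarith

/-- Centre `x` at `μ`, and put `0` in the coordinates outside `p`. -/
def centeredMask {d : ℕ} (p : Finset (Fin d)) (μ x : EuclideanSpace ℝ (Fin d)) :
    EuclideanSpace ℝ (Fin d) :=
  WithLp.toLp 2 fun j => if j ∈ p then x j - μ j else 0

/-- A missing entry becomes `0 + μ j`, and subtracting `μ j` leaves 0. This is why filling with 0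
needs no knowledge of the mean. -/
theorem adjust_zeroFill_sub {d : ℕ} {P : Fin N → Finset (Fin d)} {x : Dataset d N}
    {X : IncompleteDataset d N} {i : Fin N} (hX : X i = conceal P x i)
    (μ : EuclideanSpace ℝ (Fin d)) :
    adjust X (zeroFill X) μ i - μ = centeredMask (P i) μ (x i) := by
  ext j
  by_cases hj : j ∈ P i <;> simp [adjust, zeroFill, centeredMask, hX, conceal, hj]

/-- `B` holds the modified examples and `T` the long ones; `G` avoids both. On `G` truncation does
nothing and the data are the original draws. As `w` vanishes off `G`, sums over `G` extend to all
indices with the uncorrupted truncated vectors. -/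
theorem isGood_of_moment_bounds {d : ℕ} {ε γ β R a b : ℝ} (hN : 0 < N) (hε : 0 < ε)
    (hεγ : 11 * ε ≤ γ) (hγ : γ ≤ 1) (ha : 0 ≤ a) (hb : 0 ≤ b) (hβ : b + 5 * a ≤ β)
    {P : Fin N → Finset (Fin d)} {x : Dataset d N} {μ : EuclideanSpace ℝ (Fin d)}
    {X : IncompleteDataset d N} {B : Set (Fin N)} (hB : (B.ncard : ℝ) ≤ ε * N)
    (hX : ∀ i, i ∉ B → X i = conceal P x i) (hcomplete : IsGammaComplete γ X)
    (hcount : ∑ i, Set.indicator {y | R < ‖centeredMask (P i) μ y‖} (1 : EuclideanSpace ℝ (Fin d) → ℝ) (x i) ≤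
      0.1 * ε * N)
    (hform : ∀ u : EuclideanSpace ℝ (Fin d),
      ∑ i, inner ℝ u (truncate R (centeredMask (P i) μ (x i))) ^ 2 ≤ N * a ^ 2 * ‖u‖ ^ 2)
    (hsum : ‖∑ i, truncate R (centeredMask (P i) μ (x i))‖ ≤ N * (b * √ε))
    (hsumj : ∀ j, ‖∑ i, if j ∈ P i then truncate R (centeredMask (P i) μ (x i)) else 0‖ ≤
      N * (b * √ε)) :
    IsGood X (zeroFill X) (1.1 * ε) (0.9 * γ) 0 β μ := by
  classical
  have hN' : (0 : ℝ) < N := by exact_mod_cast hN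
  set v : Fin N → EuclideanSpace ℝ (Fin d) := fun i => truncate R (centeredMask (P i) μ (x i))
    with hv
  set T : Finset (Fin N) := Finset.univ.filter fun i => R < ‖centeredMask (P i) μ (x i)‖ with hT
  set G : Finset (Fin N) := (T ∪ B.toFinset)ᶜ with hG
  have hTcard : (T.card : ℝ) ≤ 0.1 * ε * N := by
    refine le_trans (le_of_eq ?_) hcount
    rw [hT, Finset.card_filter]
    push_cast
    refine Finset.sum_congr rfl fun i _ => ?_
    simp [Set.indicator_apply]
  have hBcard : (B.toFinset.card : ℝ) ≤ ε * N := by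
    rwa [← Set.ncard_eq_toFinset_card']
  have hunion : ((T ∪ B.toFinset).card : ℝ) ≤ 1.1 * ε * N := by
    have : ((T ∪ B.toFinset).card : ℝ) ≤ T.card + B.toFinset.card := by
      exact_mod_cast Finset.card_union_le _ _
    linarith
  have hGcard : (G.card : ℝ) = N - (T ∪ B.toFinset).card := by
    have := Finset.card_add_card_compl (T ∪ B.toFinset)
    rw [Fintype.card_fin] at this
    rw [eq_sub_iff_add_eq, add_comm]; exact_mod_cast this
  have hmem : ∀ i ∈ G, i ∉ B ∧ ‖centeredMask (P i) μ (x i)‖ ≤ R := by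
    intro i hi
    simpa [hG, hT, not_or, and_comm] using hi
  have hvG : ∀ i ∈ G, adjust X (zeroFill X) μ i - μ = v i := by
    intro i hi
    rw [adjust_zeroFill_sub (hX i (hmem i hi).1), hv]
    simp only [truncate, if_pos (hmem i hi).2]
  have hpres : ∀ i ∈ G, ∀ j, i ∈ presentIn X j ↔ j ∈ P i := by
    intro i hi j
    simp only [presentIn, Finset.mem_filter, Finset.mem_univ, true_and, hX i (hmem i hi).1, conceal]
    by_cases hj : j ∈ P i <;> simp [hj]
  refine ⟨G, ?_, fun j => ?_, fun w hw => ?_⟩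
  · rw [hGcard]; linarith
  · have hGpos : (0 : ℝ) < G.card := by rw [hGcard]; nlinarith
    rw [le_div_iff₀ hGpos]
    have hsub : presentIn X j ⊆ (G ∩ presentIn X j) ∪ (T ∪ B.toFinset) := by
      intro i hi
      by_cases h : i ∈ T ∪ B.toFinset
      · exact Finset.mem_union_right _ h
      · exact Finset.mem_union_left _ (Finset.mem_inter.2 ⟨Finset.mem_compl.2 h, hi⟩)
    have h1 : ((presentIn X j).card : ℝ) ≤
        ((G ∩ presentIn X j).card : ℝ) + ((T ∪ B.toFinset).card : ℝ) := by
      exact_mod_cast (Finset.card_le_card hsub).trans (Finset.card_union_le _ _)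
    have h2 := hcomplete j
    have h3 : (G.card : ℝ) ≤ N := by rw [hGcard]; linarith [Nat.cast_nonneg (α := ℝ) (T ∪ B.toFinset).card]
    have hγ0 : 0 < γ := by linarith
    -- At most `1.1 ε N ≤ 0.1 γ N` examples are discarded, by `11 ε ≤ γ`.
    nlinarith
  · obtain ⟨hw2, hwabs, hwsum⟩ := boundedWeights_sub_uniform hN hε (hεγ.trans hγ) hw
    obtain ⟨hw0, -, hwG, -⟩ := hw
    have hβ0 : (b + 5 * a) * √ε ≤ β * √(1.1 * ε) := by
      refine mul_le_mul hβ (Real.sqrt_le_sqrt (by linarith)) (Real.sqrt_nonneg _) ?_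
      linarith
    refine ⟨?_, ?_, fun j => ?_⟩
    · refine le_trans (le_of_eq ?_) ((norm_weighted_sum_le (q := fun _ => True) hN hε ha hwabs hwsum
        hform (by simpa using hsum)).trans hβ0)
      simp only [if_true]
      rw [← Finset.sum_subset (Finset.subset_univ G) fun i _ hi => by rw [hwG i hi, zero_smul]]
      exact congrArg _ (Finset.sum_congr rfl fun i hi => by rw [hvG i hi])
    · have e : (∑ i ∈ G, w i • Matrix.vecMulVec (adjust X (zeroFill X) μ i - μ).ofLp
          (adjust X (zeroFill X) μ i - μ).ofLp) =
          ∑ i ∈ G, w i • Matrix.vecMulVec (v i).ofLp (v i).ofLp :=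
        Finset.sum_congr rfl fun i hi => by rw [hvG i hi]
      rw [e, zero_pow two_ne_zero, zero_smul, sub_zero]
      refine (opNorm_weighted_gram_le (c := 2 * a ^ 2) hw0 (by positivity) fun u => ?_).trans ?_
      · calc ∑ i ∈ G, w i * inner ℝ u (v i) ^ 2
            ≤ ∑ i, w i * inner ℝ u (v i) ^ 2 :=
              Finset.sum_le_sum_of_subset_of_nonneg (Finset.subset_univ G)
                fun i _ _ => mul_nonneg (hw0 i) (sq_nonneg _)
          _ ≤ ∑ i, 2 / N * inner ℝ u (v i) ^ 2 :=
              Finset.sum_le_sum fun i _ => mul_le_mul_of_nonneg_right (hw2 i) (sq_nonneg _)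
          _ = 2 / N * ∑ i, inner ℝ u (v i) ^ 2 := by rw [Finset.mul_sum]
          _ ≤ 2 / N * (N * a ^ 2 * ‖u‖ ^ 2) := by gcongr; exact hform u
          _ = _ := by field_simp
      · nlinarith [mul_nonneg ha hb]
    · refine le_trans (le_of_eq ?_) ((norm_weighted_sum_le (q := fun i => j ∈ P i) hN hε ha hwabs
        hwsum hform (hsumj j)).trans hβ0)
      rw [← Finset.sum_subset (Finset.subset_univ G) fun i _ hi => by
        rw [hwG i hi, zero_smul, ite_self], ← Finset.filter_mem_eq_inter, Finset.sum_filter]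
      refine congrArg _ (Finset.sum_congr rfl fun i hi => ?_)
      rw [hvG i hi]
      exact if_congr (hpres i hi j) rfl rfl

end Deterministic

/-! ### Masked draws and conditioning on the seed -/

section Sampling

theorem inner_centeredMask {d : ℕ} (p : Finset (Fin d)) (μ x u : EuclideanSpace ℝ (Fin d)) :
    inner ℝ u (centeredMask p μ x) = ∑ j, (if j ∈ p then u j else 0) * (x j - μ j) := by
  simp only [PiLp.inner_apply, centeredMask, RCLike.inner_apply, conj_trivial]
  refine Finset.sum_congr rfl fun j _ => ?_
  split_ifs <;> ring

theorem measurable_centeredMask {d : ℕ} (p : Finset (Fin d)) (μ : EuclideanSpace ℝ (Fin d)) :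
    Measurable (centeredMask p μ) := by
  have : Continuous (centeredMask p μ) := by
    refine (PiLp.continuous_toLp 2 _).comp (continuous_pi fun j => ?_)
    split_ifs <;> fun_prop
  exact this.measurable

open Matrix in
-- The mask can be moved from the data to the test vector `u`, and zeroing coordinates of `u` does
-- not increase its norm.
theorem isCenteredSubisotropic_centeredMask {d : ℕ} {D : Measure (EuclideanSpace ℝ (Fin d))}
    (hD : D ∈ boundedCovariance d) {μ : EuclideanSpace ℝ (Fin d)} (hμ : ∫ x, x ∂D = μ)
    (p : Finset (Fin d)) : IsCenteredSubisotropic D (centeredMask p μ) := by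
  obtain ⟨hprob, hLp, hcov⟩ := hD
  have hcoord : ∀ j, MemLp (fun x : EuclideanSpace ℝ (Fin d) => x j) 2 D := fun j =>
    (EuclideanSpace.proj (𝕜 := ℝ) j).comp_memLp' hLp
  have hmean : ∀ j, ∫ x : EuclideanSpace ℝ (Fin d), x j ∂D = μ j := by
    intro j
    rw [← hμ]
    exact (EuclideanSpace.proj (𝕜 := ℝ) j).integral_comp_comm (hLp.integrable (by norm_num))
  have hsub : ∀ j, MemLp (fun x : EuclideanSpace ℝ (Fin d) => x j - μ j) 2 D := fun j =>
    (hcoord j).sub (memLp_const _)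
  have hmul : ∀ j k, Integrable
      (fun x : EuclideanSpace ℝ (Fin d) => (x j - μ j) * (x k - μ k)) D := fun j k =>
    (hsub j).integrable_mul (hsub k)
  refine ⟨measurable_centeredMask p μ, ?_, fun u => ?_, fun u => ?_⟩
  · refine (hLp.sub (memLp_const μ)).mono (measurable_centeredMask p μ).aestronglyMeasurable ?_
    filter_upwards with x
    rw [EuclideanSpace.norm_eq, EuclideanSpace.norm_eq]
    refine Real.sqrt_le_sqrt (Finset.sum_le_sum fun j _ => ?_)
    by_cases hj : j ∈ p <;> simp [centeredMask, hj, sq_nonneg]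
  · simp_rw [inner_centeredMask]
    rw [integral_finsetSum _ fun j _ => ((hsub j).integrable (by norm_num)).const_mul _]
    refine Finset.sum_eq_zero fun j _ => ?_
    rw [integral_const_mul, integral_sub ((hcoord j).integrable (by norm_num))
      (integrable_const _), hmean]
    simp
  · set c : Fin d → ℝ := fun j => if j ∈ p then u j else 0 with hc
    have e : ∀ x, inner ℝ u (centeredMask p μ x) ^ 2 =
        ∑ j, ∑ k, c j * c k * ((x j - μ j) * (x k - μ k)) := by
      intro x
      rw [inner_centeredMask, sq, Finset.sum_mul_sum]
      refine Finset.sum_congr rfl fun j _ => Finset.sum_congr rfl fun k _ => by ring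
    simp_rw [e]
    rw [integral_finsetSum _ fun j _ => integrable_finsetSum _ fun k _ => (hmul j k).const_mul _]
    simp_rw [integral_finsetSum Finset.univ fun k _ => (hmul _ k).const_mul _, integral_const_mul]
    have hentry : ∀ j k, ∫ x : EuclideanSpace ℝ (Fin d), (x j - μ j) * (x k - μ k) ∂D =
        covMatrix D j k := by
      intro j k
      simp only [covMatrix, Matrix.of_apply, covariance, hmean]
    simp_rw [hentry]
    have hpsd := hcov.dotProduct_mulVec_nonneg c
    rw [sub_mulVec, one_mulVec, dotProduct_sub, star_trivial] at hpsd
    have e2 : ∑ j, ∑ k, c j * c k * covMatrix D j k = c ⬝ᵥ (covMatrix D *ᵥ c) := by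
      simp only [dotProduct, mulVec, Finset.mul_sum]
      refine Finset.sum_congr rfl fun j _ => Finset.sum_congr rfl fun k _ => by ring
    rw [e2]
    calc c ⬝ᵥ (covMatrix D *ᵥ c) ≤ c ⬝ᵥ c := by linarith
      _ ≤ ‖u‖ ^ 2 := by
        rw [EuclideanSpace.norm_sq_eq, dotProduct]
        refine Finset.sum_le_sum fun j _ => ?_
        simp only [hc]
        split_ifs
        · rw [Real.norm_eq_abs, sq_abs, sq]
        · simp [sq_nonneg]

open Set in
/-- Conditionally on the seed, the draws are independent with laws `A.dist i`. -/
theorem CorruptionProcess.measure_draw_le {d N : ℕ} {ε : ℝ}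
    {𝓓 : Set (Measure (EuclideanSpace ℝ (Fin d)))} {Ω : Type*} [MeasurableSpace Ω]
    {Pr : Measure Ω} [IsProbabilityMeasure Pr] {S : Type*} [MeasurableSpace S]
    (A : CorruptionProcess d N ε 𝓓 Pr S) (h𝓓 : ∀ D ∈ 𝓓, IsProbabilityMeasure D)
    {Q : Set (S × Dataset d N)} (hQ : MeasurableSet Q) {c : ENNReal}
    (hc : ∀ s, Measure.pi (fun i => A.dist i s) {x | (s, x) ∈ Q} ≤ c) :
    Pr {ω | (A.seed ω, A.draw ω) ∈ Q} ≤ c := by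
  have hprob : ∀ i s, IsProbabilityMeasure (A.dist i s) := fun i s => h𝓓 _ (A.dist_mem i s)
  have hmeas : Measurable fun s => Measure.pi fun i => A.dist i s := by
    refine Measurable.measure_of_isPiSystem_of_isProbabilityMeasure generateFrom_pi.symm
      isPiSystem_pi ?_
    rintro _ ⟨B, hB, rfl⟩
    simp_rw [Measure.pi_pi]
    exact Finset.measurable_fun_prod _ fun i _ => (A.dist i).measurable_coe (hB i (mem_univ i))
  let κ : Kernel S (Dataset d N) := ⟨fun s => Measure.pi fun i => A.dist i s, hmeas⟩
  have hκ : IsMarkovKernel κ := ⟨fun s => by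
    change IsProbabilityMeasure (Measure.pi fun i => A.dist i s); infer_instance⟩
  have hpair : Measurable fun ω => (A.seed ω, A.draw ω) :=
    A.measurable_seed.prodMk A.measurable_draw
  have : IsProbabilityMeasure (Pr.map A.seed) :=
    Measure.isProbabilityMeasure_map A.measurable_seed.aemeasurable
  have : IsProbabilityMeasure (Pr.map fun ω => (A.seed ω, A.draw ω)) :=
    Measure.isProbabilityMeasure_map hpair.aemeasurable
  have hbox : ∀ s : Set S, MeasurableSet s → ∀ B : Fin N → Set (EuclideanSpace ℝ (Fin d)),
      (∀ i, MeasurableSet (B i)) →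
      (Pr.map fun ω => (A.seed ω, A.draw ω)) (s ×ˢ univ.pi B) =
        ((Pr.map A.seed) ⊗ₘ κ) (s ×ˢ univ.pi B) := by
    intro s hs B hB
    rw [Measure.map_apply hpair (hs.prod (MeasurableSet.univ_pi hB)),
      Measure.compProd_apply_prod hs (MeasurableSet.univ_pi hB)]
    have e : (fun ω => (A.seed ω, A.draw ω)) ⁻¹' (s ×ˢ univ.pi B) =
        {ω | A.seed ω ∈ s ∧ ∀ i, A.draw ω i ∈ B i} := by
      ext ω; simp
    rw [e, A.law_draw s hs B hB]
    refine lintegral_congr fun t => ?_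
    change _ = (Measure.pi fun i => A.dist i t) (univ.pi B)
    rw [Measure.pi_pi]
  have hlaw : (Pr.map fun ω => (A.seed ω, A.draw ω)) = (Pr.map A.seed) ⊗ₘ κ := by
    refine Measure.ext_prod fun {s t} hs ht => ?_
    -- With the seed event `s` fixed, both sides are finite measures in `t`, so agreement on boxes
    -- (a π-system) suffices.
    have hr : ∀ m : Measure (S × Dataset d N), ∀ t : Set (Dataset d N), MeasurableSet t →
        ((m.restrict (s ×ˢ univ)).map Prod.snd) t = m (s ×ˢ t) := by
      intro m t ht
      rw [Measure.map_apply measurable_snd ht, Measure.restrict_apply (measurable_snd ht)]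
      congr 1
      ext x; simp [and_comm]
    rw [← hr _ t ht, ← hr _ t ht]
    congr 1
    refine ext_of_generate_finite _ generateFrom_pi.symm isPiSystem_pi ?_ ?_
    · rintro _ ⟨B, hB, rfl⟩
      have hB' : ∀ i, MeasurableSet (B i) := fun i => hB i (mem_univ i)
      rw [hr _ _ (MeasurableSet.univ_pi hB'), hr _ _ (MeasurableSet.univ_pi hB'), hbox s hs B hB']
    · rw [hr _ _ MeasurableSet.univ, hr _ _ MeasurableSet.univ, ← pi_univ univ]
      exact hbox s hs _ fun _ => MeasurableSet.univ
  change Pr ((fun ω => (A.seed ω, A.draw ω)) ⁻¹' Q) ≤ c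
  rw [← Measure.map_apply hpair hQ, hlaw, Measure.compProd_apply hQ]
  calc ∫⁻ s, κ s (Prod.mk s ⁻¹' Q) ∂(Pr.map A.seed) ≤ ∫⁻ _, c ∂(Pr.map A.seed) :=
        lintegral_mono fun s => hc s
    _ = c := by simp

end Sampling

/-! ### The high-probability event -/

section Typical

open Matrix in
theorem truncatedGram_isHermitian {d N : ℕ} (R L : ℝ) (y : Dataset d N) :
    (truncatedGram R L y).IsHermitian := by
  ext a b
  simp [truncatedGram, Matrix.one_apply, eq_comm, vecMulVec_apply, Matrix.sum_apply, mul_comm]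

open Matrix in
theorem form_truncatedGram {d N : ℕ} (R L : ℝ) (y : Dataset d N) (u : Fin d → ℝ) :
    u ⬝ᵥ (truncatedGram R L y *ᵥ u) =
      L * (u ⬝ᵥ u) + ∑ i, inner ℝ (WithLp.toLp 2 u) (truncate R (y i)) ^ 2 := by
  rw [truncatedGram, add_mulVec, dotProduct_add, smul_mulVec, one_mulVec, dotProduct_smul,
    Matrix.sum_mulVec, dotProduct_sum, smul_eq_mul]
  congr 1
  refine Finset.sum_congr rfl fun i _ => ?_
  rw [vecMulVec_mulVec, op_smul_eq_smul, dotProduct_smul, smul_eq_mul,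
    EuclideanSpace.inner_eq_star_dotProduct, star_trivial,
    dotProduct_comm u (truncate R (y i)).ofLp, sq]

/-- The bounds that independent draws satisfy with high probability. -/
structure IsTypical {d N : ℕ} (R m L₁ L₂ : ℝ) (k : ℕ) (P : Fin N → Finset (Fin d))
    (μ : EuclideanSpace ℝ (Fin d)) (x : Dataset d N) : Prop where
  count : ∑ i, Set.indicator {y | R < ‖centeredMask (P i) μ y‖}
    (1 : EuclideanSpace ℝ (Fin d) → ℝ) (x i) ≤ m
  gram : ((truncatedGram R L₁ fun i => centeredMask (P i) μ (x i)) ^ k).trace ≤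
    (Real.exp 6 * L₁) ^ k
  sum : ‖∑ i, truncate R (centeredMask (P i) μ (x i))‖ ^ 2 ≤ Real.exp 16 * L₂
  sum_coord : ∀ j, ‖∑ i, if j ∈ P i then truncate R (centeredMask (P i) μ (x i)) else 0‖ ^ 2 ≤
    Real.exp 16 * L₂

/-- Joint measurability allows the bound for each fixed seed to be integrated. The failure event of
the theorem, which involves the arbitrary `draw'` and `present'`, need only be contained in the
complement of this set. -/
theorem measurableSet_isTypical {d N : ℕ} {S : Type*} [MeasurableSpace S] (R m L₁ L₂ : ℝ) (k : ℕ)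
    {P : S → Fin N → Finset (Fin d)} (hP : ∀ i j, MeasurableSet {s | j ∈ P s i})
    {μ : S → EuclideanSpace ℝ (Fin d)} (hμ : Measurable μ) :
    MeasurableSet {q : S × Dataset d N | IsTypical R m L₁ L₂ k (P q.1) (μ q.1) q.2} := by
  have hx : ∀ i, Measurable fun q : S × Dataset d N => q.2 i := fun i =>
    (measurable_pi_apply i).comp measurable_snd
  have hPq : ∀ i j, MeasurableSet {q : S × Dataset d N | j ∈ P q.1 i} := fun i j =>
    measurable_fst (hP i j)
  have hcoord : ∀ j, Measurable fun x : EuclideanSpace ℝ (Fin d) => x j := fun j =>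
    (EuclideanSpace.proj (𝕜 := ℝ) j).continuous.measurable
  have hY : ∀ i, Measurable fun q : S × Dataset d N =>
      centeredMask (P q.1 i) (μ q.1) (q.2 i) := by
    intro i
    refine (PiLp.continuous_toLp 2 _).measurable.comp (measurable_pi_lambda _ fun j => ?_)
    exact Measurable.ite (hPq i j) (((hcoord j).comp (hx i)).sub
      ((hcoord j).comp (hμ.comp measurable_fst))) measurable_const
  have hv : ∀ i, Measurable fun q : S × Dataset d N =>
      truncate R (centeredMask (P q.1 i) (μ q.1) (q.2 i)) := fun i =>
    (measurable_truncate R).comp (hY i)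
  have e : {q : S × Dataset d N | IsTypical R m L₁ L₂ k (P q.1) (μ q.1) q.2} =
      {q | ∑ i, (if R < ‖centeredMask (P q.1 i) (μ q.1) (q.2 i)‖ then (1 : ℝ) else 0) ≤ m} ∩
      {q | ((truncatedGram R L₁ fun i => centeredMask (P q.1 i) (μ q.1) (q.2 i)) ^ k).trace ≤
        (Real.exp 6 * L₁) ^ k} ∩
      {q | ‖∑ i, truncate R (centeredMask (P q.1 i) (μ q.1) (q.2 i))‖ ^ 2 ≤ Real.exp 16 * L₂} ∩
      ⋂ j, {q | ‖∑ i, if j ∈ P q.1 i then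
        truncate R (centeredMask (P q.1 i) (μ q.1) (q.2 i)) else 0‖ ^ 2 ≤ Real.exp 16 * L₂} := by
    ext q
    simp only [Set.mem_inter_iff, Set.mem_ofPred_eq, Set.mem_iInter]
    constructor
    · rintro ⟨h1, h2, h3, h4⟩
      exact ⟨⟨⟨by simpa [Set.indicator_apply] using h1, h2⟩, h3⟩, h4⟩
    · rintro ⟨⟨⟨h1, h2⟩, h3⟩, h4⟩
      exact ⟨by simpa [Set.indicator_apply] using h1, h2, h3, h4⟩
  rw [e]
  refine ((MeasurableSet.inter ?_ ?_).inter ?_).inter (MeasurableSet.iInter fun j => ?_)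
  · exact measurableSet_le (Finset.measurable_fun_sum _ fun i _ =>
      Measurable.ite (measurableSet_lt measurable_const (hY i).norm) measurable_const
        measurable_const) measurable_const
  · exact measurableSet_le ((measurable_trace_truncatedGram_pow R L₁ k).comp
      (measurable_pi_lambda _ hY)) measurable_const
  · exact measurableSet_le ((Finset.measurable_fun_sum _ fun i _ => hv i).norm.pow_const 2)
      measurable_const
  · exact measurableSet_le ((Finset.measurable_fun_sum _ fun i _ =>
      Measurable.ite (hPq i j) (hv i) measurable_const).norm.pow_const 2) measurable_const

theorem measure_pi_not_isTypical_le {d N : ℕ} {R m L₁ L₂ δ : ℝ} {k : ℕ}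
    {D : Fin N → Measure (EuclideanSpace ℝ (Fin d))} {P : Fin N → Finset (Fin d)}
    {μ : EuclideanSpace ℝ (Fin d)} (hD : ∀ i, D i ∈ boundedCovariance d)
    (hμ : ∀ i, ∫ x, x ∂(D i) = μ) (hR : 0 < R) (hk : 1 ≤ k) (hL₁ : 0 < L₁)
    (hL₁k : k * R ^ 2 ≤ L₁) (hL₁N : N ≤ L₁) (hL₂ : 0 < L₂) (hL₂R : 16 * k ^ 2 * R ^ 2 ≤ L₂)
    (hL₂N : k * d * N ≤ L₂) (hL₂' : N * (√d / R) ≤ √L₂)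
    (hδ : Real.exp (N * (2 * (d / R ^ 2)) - m) + d * Real.exp (-(3 * k)) +
      (1 + d) * Real.exp (-(3 * k)) ≤ δ) :
    Measure.pi D {x | ¬ IsTypical R m L₁ L₂ k P μ x} ≤ ENNReal.ofReal δ := by
  have hprob : ∀ i, IsProbabilityMeasure (D i) := fun i => (hD i).1
  have hY : ∀ i, IsCenteredSubisotropic (D i) (centeredMask (P i) μ) := fun i =>
    isCenteredSubisotropic_centeredMask (hD i) (hμ i) (P i)
  have b1 := measure_pi_count_le hY hR m
  have b2 := measure_pi_trace_le hY hR.le hL₁ hL₁k hL₁N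
  have b3 := measure_pi_norm_sum_le hY hR hL₂ hk hL₂R hL₂N hL₂' (fun _ => True)
  have b4 := fun j => measure_pi_norm_sum_le hY hR hL₂ hk hL₂R hL₂N hL₂' (fun i => j ∈ P i)
  simp only [if_true] at b3
  refine (measure_mono (fun x hx => ?_)).trans ((measure_union_le _ _).trans
    ((add_le_add ((measure_union_le _ _).trans (add_le_add b1 b2)) ((measure_union_le _ _).trans
      (add_le_add b3 ((measure_iUnion_fintype_le _ _).trans
        (Finset.sum_le_sum fun j _ => b4 j))))).trans ?_))
  · by_contra hcon
    simp only [Set.mem_union, Set.mem_ofPred_eq, Set.mem_iUnion, not_or, not_lt, not_exists] at hcon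
    exact hx ⟨hcon.1.1, hcon.1.2, hcon.2.1, hcon.2.2⟩
  · rw [Finset.sum_const, Finset.card_univ, Fintype.card_fin, nsmul_eq_mul,
      ← ENNReal.ofReal_natCast, ← ENNReal.ofReal_mul (by positivity),
      ← ENNReal.ofReal_add (by positivity) (by positivity),
      ← ENNReal.ofReal_add (by positivity) (by positivity),
      ← ENNReal.ofReal_add (by positivity) (by positivity)]
    refine ENNReal.ofReal_le_ofReal (le_trans (le_of_eq ?_) hδ)
    ring

open Matrix in
theorem isGood_of_isTypical {d N : ℕ} {ε γ β R a b L₁ L₂ : ℝ} {k : ℕ} (hN : 0 < N) (hε : 0 < ε)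
    (hεγ : 11 * ε ≤ γ) (hγ : γ ≤ 1) (ha : 0 ≤ a) (hb : 0 ≤ b) (hβ : b + 5 * a ≤ β)
    (hk : k ≠ 0) (hL₁ : 0 ≤ L₁) (hL₁a : Real.exp 6 * L₁ ≤ N * a ^ 2)
    (hL₂b : Real.exp 16 * L₂ ≤ (N * (b * √ε)) ^ 2)
    {P : Fin N → Finset (Fin d)} {x : Dataset d N} {μ : EuclideanSpace ℝ (Fin d)}
    {X : IncompleteDataset d N} {B : Set (Fin N)} (hB : (B.ncard : ℝ) ≤ ε * N)
    (hX : ∀ i, i ∉ B → X i = conceal P x i) (hcomplete : IsGammaComplete γ X)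
    (h : IsTypical R (0.1 * ε * N) L₁ L₂ k P μ x) :
    IsGood X (zeroFill X) (1.1 * ε) (0.9 * γ) 0 β μ := by
  have hself : ∀ u : EuclideanSpace ℝ (Fin d), u.ofLp ⬝ᵥ u.ofLp = ‖u‖ ^ 2 := fun u => by
    rw [EuclideanSpace.norm_sq_eq]; simp [dotProduct, sq]
  have hnn : ∀ u : Fin d → ℝ, 0 ≤ u ⬝ᵥ u := fun u => by
    rw [dotProduct]; exact Finset.sum_nonneg fun _ _ => mul_self_nonneg _
  have hb' : 0 ≤ N * (b * √ε) := by positivity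
  refine isGood_of_moment_bounds hN hε hεγ hγ ha hb hβ hB hX hcomplete h.count (fun u => ?_)
    (abs_le_of_sq_le_sq' (h.sum.trans hL₂b) hb').2
    fun j => (abs_le_of_sq_le_sq' ((h.sum_coord j).trans hL₂b) hb').2
  have hf := form_le_of_trace_pow_le (truncatedGram_isHermitian R L₁ _)
    (fun v => by
      rw [form_truncatedGram]
      exact add_nonneg (mul_nonneg hL₁ (hnn v)) (Finset.sum_nonneg fun _ _ => sq_nonneg _))
    hk (by positivity) h.gram u.ofLp
  rw [form_truncatedGram, hself] at hf
  have h1 : 0 ≤ L₁ * ‖u‖ ^ 2 := by positivity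
  have h2 := mul_le_mul_of_nonneg_right hL₁a (sq_nonneg ‖u‖)
  have e : WithLp.toLp 2 u.ofLp = u := rfl
  rw [e] at hf
  linarith

end Typical

/-! ### Choice of parameters and conclusion -/

theorem mainTheorem6 :
    ∃ K C : ℝ, 0 < K ∧ 0 < C ∧
      ∀ (d N : ℕ) (ε γ δ : ℝ), 1 ≤ d → 0 < ε → 11 * ε ≤ γ → γ ≤ 1 → 0 < δ → δ < 1 / 2 →
        K * Real.log (d / δ) ≤ N * ε →
        ∀ (Ω : Type*) [MeasurableSpace Ω] (Pr : Measure Ω) [IsProbabilityMeasure Pr]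
          (S : Type*) [MeasurableSpace S]
          (A : CorruptionProcess d N ε (boundedCovariance d) Pr S),
          Pr {ω | IsGammaComplete γ (A.observed ω) ∧
              ¬ IsGood (A.observed ω) (zeroFill (A.observed ω)) (1.1 * ε) (0.9 * γ) 0
                  (C * √(d * Real.log (d / δ) / (N * ε) + 1)) (A.trueMean ω)}
            ≤ ENNReal.ofReal δ := by
  refine ⟨100, 300 * Real.exp 8, by norm_num, by positivity, ?_⟩
  intro d N ε γ δ hd hε hεγ hγ hδ hδ2 hNε Ω _ Pr _ S _ A
  have hd1 : (1 : ℝ) ≤ d := by exact_mod_cast hd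
  set l := Real.log (d / δ) with hl
  have hdδ : 2 ≤ d / δ := by rw [le_div_iff₀ hδ]; linarith
  have hl0 : 1 / 2 ≤ l := by
    have := Real.log_le_log (by norm_num) hdδ
    linarith [Real.log_two_gt_d9]
  have hN' : (0 : ℝ) < N := by
    by_contra hcon
    nlinarith
  have hN : 0 < N := by exact_mod_cast hN'
  set k := ⌈l⌉₊ with hkdef
  have hk1 : 1 ≤ k := Nat.one_le_ceil_iff.2 (by linarith)
  -- With this `k`, `e^(-3k) ≤ (δ/d)^3`: enough for the `2 d + 1` terms of this size in the union
  -- bound.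
  have hlk : l ≤ k := Nat.le_ceil l
  have hk3 : (k : ℝ) ≤ 3 * l := by linarith [Nat.ceil_lt_add_one (show 0 ≤ l by linarith)]
  -- The expected number of truncated vectors is then at most `ε N / 100`, well below the allowance
  -- `0.1 ε N`; the Chernoff exponent becomes `-0.08 ε N ≤ -3 l`.
  set R := √(100 * d / ε) with hR
  have hR2 : R ^ 2 = 100 * d / ε := Real.sq_sqrt (by positivity)
  have hR0 : 0 < R := by positivity
  set L₁ : ℝ := k * R ^ 2 + N with hL₁
  -- The summands are the jump, variance and bias requirements of `measure_pi_norm_sum_le`.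
  set L₂ : ℝ := 16 * k ^ 2 * R ^ 2 + k * d * N + N ^ 2 * ε with hL₂
  set B := d * l / (N * ε) + 1 with hBdef
  have hB0 : 0 < B := by positivity
  have hNB : N * ε * B = d * l + N * ε := by rw [hBdef]; field_simp
  have hlN : l ≤ N * ε := by linarith
  have hkl : (k : ℝ) / ε * d ≤ 3 * (N * B) - 3 * N := by
    have e : 3 * (N * B) - 3 * N = 3 * l / ε * d := by rw [hBdef]; field_simp; ring
    rw [e]; gcongr
  have hL₁B : L₁ ≤ 400 * (N * B) := by
    have e : (k : ℝ) * R ^ 2 = 100 * (k / ε * d) := by rw [hR2]; ring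
    have h1 : (0 : ℝ) ≤ N * B := by positivity
    rw [hL₁, e]; linarith
  have hL₂B : L₂ ≤ 40000 * (N ^ 2 * ε * B) := by
    have e : 16 * (k : ℝ) ^ 2 * R ^ 2 = 1600 * (k * (k / ε) * d) := by rw [hR2]; ring
    have e1 : N ^ 2 * ε * B = N * (d * l) + N ^ 2 * ε := by
      calc N ^ 2 * ε * B = N * (N * ε * B) := by ring
        _ = _ := by rw [hNB]; ring
    -- Here `l ≤ N ε` enters: it absorbs the jump term `k² d / ε` into `N d l`.
    have h1 : (k : ℝ) / ε ≤ 3 * N := by rw [div_le_iff₀ hε]; linarith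
    have h2 : (k : ℝ) * (k / ε) * d ≤ (3 * l) * (3 * N) * d := by gcongr
    have h3 : (k : ℝ) * d * N ≤ 3 * l * d * N := by gcongr
    have h4 : 0 ≤ N ^ 2 * ε := by positivity
    have h5 : 0 ≤ N * (d * l) := by positivity
    rw [hL₂, e, e1]; linarith
  have hexp : Real.exp (-(3 * k)) ≤ (δ / d) ^ 3 := by
    have e : δ / d = Real.exp (-l) := by
      rw [Real.exp_neg, hl, Real.exp_log (by positivity), inv_div]
    rw [e, ← Real.exp_nat_mul]
    exact Real.exp_le_exp.2 (by push_cast; linarith)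
  have hexp1 : Real.exp (N * (2 * (d / R ^ 2)) - 0.1 * ε * N) ≤ (δ / d) ^ 3 := by
    have e : δ / d = Real.exp (-l) := by
      rw [Real.exp_neg, hl, Real.exp_log (by positivity), inv_div]
    have e1 : d / R ^ 2 = ε / 100 := by rw [hR2]; field_simp
    rw [e, ← Real.exp_nat_mul, e1]
    exact Real.exp_le_exp.2 (by push_cast; linarith)
  have hδle : Real.exp (N * (2 * (d / R ^ 2)) - 0.1 * ε * N) + d * Real.exp (-(3 * k)) +
      (1 + d) * Real.exp (-(3 * k)) ≤ δ := by
    set q := δ / d with hq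
    have hq0 : 0 < q := by positivity
    have hq2 : q ≤ 1 / 2 := by rw [hq, div_le_iff₀ (by linarith)]; linarith
    have hdq : d * q = δ := by rw [hq]; field_simp
    have h1 : d * Real.exp (-(3 * k)) ≤ d * q ^ 3 := by gcongr
    have h2 : (1 + d) * Real.exp (-(3 * k)) ≤ (1 + d) * q ^ 3 := by gcongr
    have h3 : q ^ 3 ≤ d * q ^ 3 := le_mul_of_one_le_left (by positivity) hd1
    have h4 : d * q ^ 3 ≤ δ * (1 / 4) := by
      calc d * q ^ 3 = δ * q ^ 2 := by rw [← hdq]; ring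
        _ ≤ δ * (1 / 4) := by gcongr; nlinarith
    linarith
  have hL₂' : N * (√d / R) ≤ √L₂ := by
    refine Real.le_sqrt_of_sq_le ?_
    rw [mul_pow, div_pow, Real.sq_sqrt (by positivity), hR2]
    have e : (N : ℝ) ^ 2 * (d / (100 * d / ε)) = N ^ 2 * ε / 100 := by field_simp
    have h1 : 0 ≤ N ^ 2 * ε := by positivity
    have h2 : (0 : ℝ) ≤ 16 * k ^ 2 * R ^ 2 + k * d * N := by positivity
    rw [e, hL₂]; linarith
  have hR20 : (0 : ℝ) ≤ 16 * k ^ 2 * R ^ 2 := by positivity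
  have hkdN : (0 : ℝ) ≤ k * d * N := by positivity
  have hNNε : 0 < N ^ 2 * ε := by positivity
  have hkR : (0 : ℝ) ≤ k * R ^ 2 := by positivity
  have hL₁0 : 0 < L₁ := by rw [hL₁]; linarith
  have hL₂0 : 0 < L₂ := by rw [hL₂]; linarith
  have hpi : ∀ s, Measure.pi (fun i => A.dist i s)
      {x | ¬ IsTypical R (0.1 * ε * N) L₁ L₂ k (A.present s) (A.mean s) x} ≤ ENNReal.ofReal δ :=
    fun s => measure_pi_not_isTypical_le (fun i => A.dist_mem i s) (fun i => A.dist_mean i s) hR0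
      hk1 hL₁0 (by rw [hL₁]; linarith) (by rw [hL₁]; linarith) hL₂0 (by rw [hL₂]; linarith)
      (by rw [hL₂]; linarith) hL₂' hδle
  have ha : Real.exp 6 * L₁ ≤ N * (20 * Real.exp 3 * √B) ^ 2 := by
    have e : Real.exp 6 = Real.exp 3 ^ 2 := by rw [← Real.exp_nat_mul]; norm_num
    calc Real.exp 6 * L₁ ≤ Real.exp 6 * (400 * (N * B)) := by gcongr
      _ = N * (20 * Real.exp 3 * √B) ^ 2 := by
        rw [e, mul_pow, mul_pow, Real.sq_sqrt hB0.le]; ring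
  have hb : Real.exp 16 * L₂ ≤ (N * (200 * Real.exp 8 * √B * √ε)) ^ 2 := by
    have e : Real.exp 16 = Real.exp 8 ^ 2 := by rw [← Real.exp_nat_mul]; norm_num
    calc Real.exp 16 * L₂ ≤ Real.exp 16 * (40000 * (N ^ 2 * ε * B)) := by gcongr
      _ = (N * (200 * Real.exp 8 * √B * √ε)) ^ 2 := by
        rw [e, mul_pow, mul_pow, mul_pow, mul_pow, Real.sq_sqrt hB0.le, Real.sq_sqrt hε.le]; ring
  -- The values `a = 20 e³ √B` and `b = 200 e⁸ √B` are the square roots of the bounds on `L₁` and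
  -- `L₂`; they determine `C`.
  have hβ : 200 * Real.exp 8 * √B + 5 * (20 * Real.exp 3 * √B) ≤ 300 * Real.exp 8 * √B := by
    have h1 : Real.exp 3 ≤ Real.exp 8 := Real.exp_le_exp.2 (by norm_num)
    have h2 := mul_le_mul_of_nonneg_right h1 (Real.sqrt_nonneg B)
    linarith
  clear_value L₁ L₂ B R k
  refine (measure_mono fun ω hω => ?_).trans (A.measure_draw_le (fun D hD => hD.1)
    (measurableSet_isTypical R (0.1 * ε * N) L₁ L₂ k A.measurable_present A.measurable_mean).compl
    hpi)
  intro htyp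
  refine hω.2 (isGood_of_isTypical hN hε hεγ hγ (by positivity) (by positivity) hβ (by omega)
    hL₁0.le ha hb (A.card_modified ω) (fun i hi => ?_) hω.1 htyp)
  simp only [Set.mem_ofPred_eq, not_or, not_not] at hi
  funext j
  simp only [CorruptionProcess.observed, conceal, hi.1, hi.2]
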